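/- Let $n\ge 1$ and let $1<p<q$ be real numbers. A convex body in $\mathbb{R}^n$ is a compact convex set with non-empty interior; it is centered if $\mathbb{E}[X]=0$ for $X$ uniformly distributed on it. For a centered convex body $K\subset\mathbb{R}^n$ and $X\sim\mathrm{Uni}(K)$ put $$\alpha(K)=\max_{\theta\in S^{n-1}}\frac{\lVert X\cdot\theta\rVert_q}{\lVert X\cdot\theta\rVert_p},\qquad \lVert Y\rVert_r=(\mathbb{E}|Y|^r)^{1/r}.$$ Let $\Delta_n\subset\mathbb{R}^n$ be any centered $n$-dimensional simplex (the convex hull of $n+1$ affinely independent points), and let $K\subset\mathbb{R}^n$ be any centered convex body. Then the maxima defining $\alpha(K)$ and $\alpha(\Delta_n)$ are attained, and $$\alpha(K)\le\alpha(\Delta_n).$$ Moreover, let $\theta_1,\theta_2$ be the outer unit normals of any two distinct facets of $\Delta_n$, let $\Gamma_n\sim\mathrm{Uni}(\Delta_n)$, and put $$\Gamma_n^s=\frac{s\theta_1-(1-s)\theta_2}{|s\theta_1-(1-s)\theta_2|}\cdot\Gamma_n,\qquad 0\le s\le 1.$$ Then $\lVert\Gamma_n^s\rVert_q/\lVert\Gamma_n^s\rVert_p=\alpha(\Delta_n)$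 for some $s\in[0,1]$; and whenever $\theta\in S^{n-1}$ satisfies $\lVert X\cdot\theta\rVert_q/\lVert X\cdot\theta\rVert_p=\alpha(\Delta_n)$, where $X\sim\mathrm{Uni}(K)$, there are $s\in[0,1]$ and $c>0$ such that $X\cdot\theta$ has the same law as $c\,\Gamma_n^s$. -/

import Mathlib

open MeasureTheory ProbabilityTheory

/-- A convex body in `ℝⁿ`: a compact convex set with non-empty interior. -/
structure IsConvexBody {n : ℕ} (K : Set (EuclideanSpace ℝ (Fin n))) : Prop where
  convex : Convex ℝ K
  isCompact : IsCompact K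
  nonempty_interior : (interior K).Nonempty

/-- The uniform distribution on `K`: Lebesgue measure restricted to `K`, normalized. -/
noncomputable def uniformLaw {n : ℕ} (K : Set (EuclideanSpace ℝ (Fin n))) :
    Measure (EuclideanSpace ℝ (Fin n)) :=
  ProbabilityTheory.cond volume K

/-- `K` is centered: a random vector uniform on `K` has mean zero. -/
def IsCentered {n : ℕ} (K : Set (EuclideanSpace ℝ (Fin n))) : Prop :=
  ∫ x, x ∂(uniformLaw K) = 0

/-- The law of the marginal `X · θ`, where `X` is uniform on `K`. -/
noncomputable def marginalLaw {n : ℕ} (K : Set (EuclideanSpace ℝ (Fin n)))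
    (θ : EuclideanSpace ℝ (Fin n)) : Measure ℝ :=
  (uniformLaw K).map (fun x => inner ℝ x θ)

/-- The norm ratio `‖X · θ‖_q / ‖X · θ‖_p`, where `X` is uniform on `K`. -/
noncomputable def normRatio {n : ℕ} (p q : ℝ) (K : Set (EuclideanSpace ℝ (Fin n)))
    (θ : EuclideanSpace ℝ (Fin n)) : ℝ :=
  (eLpNorm (fun x => inner ℝ x θ) (ENNReal.ofReal q) (uniformLaw K)).toReal /
    (eLpNorm (fun x => inner ℝ x θ) (ENNReal.ofReal p) (uniformLaw K)).toReal

/-- `α(K)`: the supremum of the norm ratio over all unit directions. -/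
noncomputable def alpha {n : ℕ} (p q : ℝ) (K : Set (EuclideanSpace ℝ (Fin n))) : ℝ :=
  sSup (normRatio p q K '' Metric.sphere 0 1)

/-- The solid simplex spanned by the vertices of `T`. -/
def solidSimplex {n : ℕ} (T : Affine.Simplex ℝ (EuclideanSpace ℝ (Fin n)) n) :
    Set (EuclideanSpace ℝ (Fin n)) :=
  convexHull ℝ (Set.range T.points)

/-- `u` is the outer unit normal to the facet of the simplex opposite to vertex `i`. -/
def IsOuterUnitNormal {n : ℕ} (T : Affine.Simplex ℝ (EuclideanSpace ℝ (Fin n)) n)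
    (i : Fin (n + 1)) (u : EuclideanSpace ℝ (Fin n)) : Prop :=
  ‖u‖ = 1 ∧ ∃ h : ℝ, (∀ j, j ≠ i → inner ℝ (T.points j) u = h) ∧ inner ℝ (T.points i) u < h

/-- The unit vector `(s u - (1 - s) v) / |s u - (1 - s) v|`. -/
noncomputable def interpDirection {n : ℕ} (u v : EuclideanSpace ℝ (Fin n)) (s : ℝ) :
    EuclideanSpace ℝ (Fin n) :=
  ‖s • u - (1 - s) • v‖⁻¹ • (s • u - (1 - s) • v)

/-!
By the Brunn–Minkowski inequality, the density of a marginal of a convex body in `ℝ^(k + 1)` is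
`φ ^ k` with `φ` concave on its support. A simplex has extremal marginals: in a direction whose
inner products with all vertices but two coincide, the root `γ` of the density is a tent, affine
on both sides of its peak. The directions `s • u - (1 - s) • v` for two facet normals `u` and `v`
are of this kind. As `s` runs through `[0, 1]`, the ratio of the `p`-moments of the marginal on the
two half-lines passes from one extreme value to the other, so some `s` and some scaling match both
half-line `p`-moments of any given marginal `φ ^ k`.

Suppose that they are matched. A concave function crosses a tent only a few times, so
`D = γ ^ k - φ ^ k` changes sign few times. Since `D` has mass and mean zero, its stop-loss
transform `G z = ∫ (t - z)₊ D t` vanishes at infinity on both sides, and by Rolle's theorem each of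
the two integrations loses at least one sign change; hence `G` changes sign at most once on each
half-line. Vanishing of the `p`-th moment of `D` on `(0, ∞)` says `∫ z ^ (p - 2) G z = 0`, and
weighting by the increasing function `z ^ (q - p)` then makes the `q`-th moment of `D` nonnegative,
with equality only if `G = 0`, that is, if the two laws coincide.
-/

section BrunnMinkowski

open scoped ENNReal Pointwise

lemma volume_add_volume_le_volume_add_of_isCompact {A B : Set ℝ} (hA : IsCompact A)
    (hB : IsCompact B) (hA₀ : A.Nonempty) (hB₀ : B.Nonempty) :
    volume A + volume B ≤ volume (A + B) := by
  obtain ⟨a, haA, ha⟩ := hA.exists_isGreatest hA₀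
  obtain ⟨b, hbB, hb⟩ := hB.exists_isLeast hB₀
  -- The translates `b + A` and `a + B` of the two sets meet only in `a + b`.
  have hinter : (b +ᵥ A) ∩ (a +ᵥ B) ⊆ {a + b} := by
    rintro _ ⟨⟨x, hx, rfl⟩, y, hy, hxy⟩
    simp only [vadd_eq_add, Set.mem_singleton_iff] at hxy ⊢
    linarith [ha hx, hb hy]
  calc volume A + volume B = volume (b +ᵥ A) + volume (a +ᵥ B) := by simp only [measure_vadd]
    _ = volume ((b +ᵥ A) ∪ (a +ᵥ B)) := by
      rw [measure_union₀ (hB.vadd a).measurableSet.nullMeasurableSet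
        (measure_mono_null hinter (by simp))]
    _ ≤ volume (A + B) := measure_mono <| Set.union_subset
      (add_comm A B ▸ Set.vadd_set_subset_vadd hbB) (Set.vadd_set_subset_vadd haA)

lemma volume_add_volume_le_of_add_subset {A B C : Set ℝ} (hA : MeasurableSet A)
    (hB : MeasurableSet B) (hA₀ : A.Nonempty) (hB₀ : B.Nonempty) (hC : A + B ⊆ C) :
    volume A + volume B ≤ volume C := by
  obtain ⟨a, ha⟩ := hA₀
  obtain ⟨b, hb⟩ := hB₀
  rw [hA.measure_eq_iSup_isCompact, hB.measure_eq_iSup_isCompact]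
  simp only [iSup_and']
  refine ENNReal.biSup_add_biSup_le' ⟨∅, by simp⟩ ⟨∅, by simp⟩ fun K ⟨hKA, hK⟩ L ⟨hLB, hL⟩ => ?_
  calc volume K + volume L ≤ volume (insert a K) + volume (insert b L) := by
        gcongr <;> exact Set.subset_insert _ _
    _ ≤ volume (insert a K + insert b L) := volume_add_volume_le_volume_add_of_isCompact
        (hK.insert a) (hL.insert b) (Set.insert_nonempty _ _) (Set.insert_nonempty _ _)
    _ ≤ volume C := measure_mono <| (Set.add_subset_add (Set.insert_subset ha hKA)
        (Set.insert_subset hb hLB)).trans hC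

lemma lintegral_eq_lintegral_measure_lt {α : Type*} [MeasurableSpace α] (μ : Measure α)
    {u : α → ℝ≥0∞} (hu : Measurable u) (hu_top : ∀ x, u x ≠ ⊤) :
    ∫⁻ x, u x ∂μ = ∫⁻ t in Set.Ioi (0 : ℝ), μ {x | ENNReal.ofReal t < u x} := by
  have hlayer := lintegral_eq_lintegral_meas_lt μ (f := fun x => (u x).toReal)
    (Filter.Eventually.of_forall fun _ => ENNReal.toReal_nonneg) hu.ennreal_toReal.aemeasurable
  simp only [ENNReal.ofReal_toReal (hu_top _)] at hlayer
  rw [hlayer]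
  refine setLIntegral_congr_fun measurableSet_Ioi fun t ht => ?_
  simp only [ENNReal.ofReal_lt_iff_lt_toReal (le_of_lt ht) (hu_top _)]

lemma measurable_measure_ofReal_lt {α : Type*} [MeasurableSpace α] (μ : Measure α)
    (u : α → ℝ≥0∞) : Measurable fun t : ℝ => μ {x | ENNReal.ofReal t < u x} :=
  Antitone.measurable fun _ _ hst =>
    measure_mono fun _ hx => (ENNReal.ofReal_le_ofReal hst).trans_lt hx

lemma rpow_mul_rpow_le_weighted_add {l : ℝ} (hl₀ : 0 < l) (hl₁ : l < 1) (x y : ℝ≥0∞) :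
    x ^ (1 - l) * y ^ l ≤ ENNReal.ofReal (1 - l) * x + ENNReal.ofReal l * y := by
  have hl : 0 < 1 - l := sub_pos.2 hl₁
  have hconj : (1 - l)⁻¹.HolderConjugate l⁻¹ :=
    ⟨by simp, by positivity, by positivity⟩
  have hyoung := ENNReal.young_inequality (x ^ (1 - l)) (y ^ l) hconj
  rwa [← ENNReal.rpow_mul, ← ENNReal.rpow_mul, mul_inv_cancel₀ hl.ne', mul_inv_cancel₀ hl₀.ne',
    ENNReal.rpow_one, ENNReal.rpow_one, ENNReal.ofReal_inv_of_pos hl, ENNReal.ofReal_inv_of_pos hl₀,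
    div_eq_mul_inv, div_eq_mul_inv, inv_inv, inv_inv, mul_comm x, mul_comm y] at hyoung

/-- `μ` satisfies the Prékopa–Leindler inequality. Stating this as a property of the measure lets
the inequality be transported along products and linear maps. -/
def IsPrekopaLeindler {E : Type*} [AddCommGroup E] [Module ℝ E] [MeasurableSpace E]
    (μ : Measure E) : Prop :=
  ∀ ⦃l : ℝ⦄, 0 < l → l < 1 → ∀ ⦃f g h : E → ℝ≥0∞⦄, Measurable f → Measurable g → Measurable h →
    (∀ x y, f x ^ (1 - l) * g y ^ l ≤ h ((1 - l) • x + l • y)) →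
    (∫⁻ x, f x ∂μ) ^ (1 - l) * (∫⁻ x, g x ∂μ) ^ l ≤ ∫⁻ x, h x ∂μ

section Real

variable {f g h : ℝ → ℝ≥0∞} {l : ℝ}

lemma weighted_volume_lt_le (hf : Measurable f) (hg : Measurable g) (hl₀ : 0 < l) (hl₁ : l < 1)
    (H : ∀ x y, f x ^ (1 - l) * g y ^ l ≤ h ((1 - l) • x + l • y)) {a : ℝ≥0∞}
    (hfa : a < ⨆ x, f x) (hga : a < ⨆ x, g x) :
    ENNReal.ofReal (1 - l) * volume {x | a < f x} + ENNReal.ofReal l * volume {x | a < g x} ≤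
      volume {x | a < h x} := by
  have hl : 0 < 1 - l := sub_pos.2 hl₁
  have hvol : ∀ {c : ℝ} (_ : 0 < c) (S : Set ℝ), ENNReal.ofReal c * volume S = volume (c • S) :=
    fun hc S => by simp [Measure.addHaar_smul, abs_of_pos hc]
  have hf_ne : {x | a < f x}.Nonempty := lt_iSup_iff.1 hfa
  have hg_ne : {x | a < g x}.Nonempty := lt_iSup_iff.1 hga
  rw [hvol hl, hvol hl₀]
  refine volume_add_volume_le_of_add_subset ((measurableSet_lt measurable_const hf).const_smul₀ _)
    ((measurableSet_lt measurable_const hg).const_smul₀ _) hf_ne.smul_set hg_ne.smul_set ?_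
  rintro _ ⟨_, ⟨x, hx, rfl⟩, _, ⟨y, hy, rfl⟩, rfl⟩
  calc a = a ^ (1 - l) * a ^ l := by
        rw [← ENNReal.rpow_add_of_nonneg _ _ hl.le hl₀.le, sub_add_cancel, ENNReal.rpow_one]
    _ < f x ^ (1 - l) * g y ^ l :=
        ENNReal.mul_lt_mul (ENNReal.rpow_lt_rpow hx hl) (ENNReal.rpow_lt_rpow hy hl₀)
    _ ≤ _ := H x y

lemma weighted_lintegral_le_of_iSup_eq_one (hf : Measurable f) (hg : Measurable g)
    (hh : Measurable h) (hl₀ : 0 < l) (hl₁ : l < 1) (hf₁ : ⨆ x, f x = 1) (hg₁ : ⨆ x, g x = 1)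
    (H : ∀ x y, f x ^ (1 - l) * g y ^ l ≤ h ((1 - l) • x + l • y)) :
    ENNReal.ofReal (1 - l) * (∫⁻ x, f x) + ENNReal.ofReal l * (∫⁻ x, g x) ≤ ∫⁻ x, h x := by
  have hf_le : ∀ x, f x ≤ 1 := fun x => hf₁ ▸ le_iSup f x
  have hg_le : ∀ x, g x ≤ 1 := fun x => hg₁ ▸ le_iSup g x
  have layer : ∀ {u : ℝ → ℝ≥0∞}, Measurable u → (∀ x, u x ≤ 1) →
      ∫⁻ x, u x = ∫⁻ t in Set.Ioi (0 : ℝ), volume {x | ENNReal.ofReal t < u x} := fun hu hu₁ =>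
    lintegral_eq_lintegral_measure_lt _ hu fun x => ne_top_of_le_ne_top ENNReal.one_ne_top (hu₁ x)
  calc _ = ∫⁻ t in Set.Ioi (0 : ℝ), (ENNReal.ofReal (1 - l) * volume {x | ENNReal.ofReal t < f x} +
        ENNReal.ofReal l * volume {x | ENNReal.ofReal t < g x}) := by
        rw [layer hf hf_le, layer hg hg_le,
          lintegral_add_left ((measurable_measure_ofReal_lt _ f).const_mul _),
          lintegral_const_mul _ (measurable_measure_ofReal_lt _ f),
          lintegral_const_mul _ (measurable_measure_ofReal_lt _ g)]
    _ ≤ ∫⁻ t in Set.Ioi (0 : ℝ), volume {x | ENNReal.ofReal t < min (h x) 1} := by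
        refine setLIntegral_mono' measurableSet_Ioi fun t _ => ?_
        rcases lt_or_ge (ENNReal.ofReal t) 1 with ht | ht
        · simpa only [lt_min_iff, ht, and_true] using weighted_volume_lt_le hf hg hl₀ hl₁ H
            (ht.trans_eq hf₁.symm) (ht.trans_eq hg₁.symm)
        · simp [((hf_le _).trans ht).not_gt, ((hg_le _).trans ht).not_gt]
    _ = ∫⁻ x, min (h x) 1 := (layer (hh.min measurable_const) fun _ => min_le_right _ _).symm
    _ ≤ ∫⁻ x, h x := lintegral_mono fun _ => min_le_left _ _

lemma prekopa_leindler_real_of_bounded (hf : Measurable f) (hg : Measurable g) (hh : Measurable h)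
    (hl₀ : 0 < l) (hl₁ : l < 1) (hf_top : ⨆ x, f x ≠ ⊤) (hg_top : ⨆ x, g x ≠ ⊤)
    (H : ∀ x y, f x ^ (1 - l) * g y ^ l ≤ h ((1 - l) • x + l • y)) :
    (∫⁻ x, f x) ^ (1 - l) * (∫⁻ x, g x) ^ l ≤ ∫⁻ x, h x := by
  have hl : 0 < 1 - l := sub_pos.2 hl₁
  rcases eq_or_ne (⨆ x, f x) 0 with hf₀ | hf₀
  · simp [ENNReal.iSup_eq_zero.1 hf₀, hl]
  rcases eq_or_ne (⨆ x, g x) 0 with hg₀ | hg₀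
  · simp [ENNReal.iSup_eq_zero.1 hg₀, hl₀]
  set α := ⨆ x, f x
  set β := ⨆ x, g x
  have hα := ENNReal.rpow_ne_top_of_nonneg hl.le hf_top
  have hβ := ENNReal.rpow_ne_top_of_nonneg hl₀.le hg_top
  set c := α ^ (1 - l) * β ^ l with hc
  have hc₀ : c ≠ 0 :=
    mul_ne_zero (by simp [hf₀, hf_top]) (by simp [hg₀, hg_top])
  have hc_top : c ≠ ⊤ := ENNReal.mul_ne_top hα hβ
  have normalize : ∀ a b : ℝ≥0∞,
      (α⁻¹ * a) ^ (1 - l) * (β⁻¹ * b) ^ l = c⁻¹ * (a ^ (1 - l) * b ^ l) := fun a b => by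
    rw [ENNReal.mul_rpow_of_nonneg _ _ hl.le, ENNReal.mul_rpow_of_nonneg _ _ hl₀.le,
      ENNReal.inv_rpow, ENNReal.inv_rpow, hc, ENNReal.mul_inv (Or.inr hβ) (Or.inl hα)]
    ring
  have key := weighted_lintegral_le_of_iSup_eq_one (f := fun x => α⁻¹ * f x)
    (g := fun x => β⁻¹ * g x) (h := fun x => c⁻¹ * h x) (hf.const_mul _) (hg.const_mul _)
    (hh.const_mul _) hl₀ hl₁ (by rw [← ENNReal.mul_iSup, ENNReal.inv_mul_cancel hf₀ hf_top])
    (by rw [← ENNReal.mul_iSup, ENNReal.inv_mul_cancel hg₀ hg_top])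
    fun x y => (normalize _ _).trans_le (mul_le_mul_right (H x y) _)
  rw [lintegral_const_mul _ hf, lintegral_const_mul _ hg, lintegral_const_mul _ hh] at key
  refine (ENNReal.mul_le_mul_iff_right (ENNReal.inv_ne_zero.2 hc_top)
    (ENNReal.inv_ne_top.2 hc₀)).1 ?_
  exact (normalize _ _).symm.trans_le ((rpow_mul_rpow_le_weighted_add hl₀ hl₁ _ _).trans key)

lemma lintegral_rpow_eq_iSup_min_natCast {α : Type*} [MeasurableSpace α] (μ : Measure α)
    {u : α → ℝ≥0∞} (hu : Measurable u) {r : ℝ} (hr : 0 < r) :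
    (∫⁻ x, u x ∂μ) ^ r = ⨆ M : ℕ, (∫⁻ x, min (u x) M ∂μ) ^ r := by
  have hsup : ∀ x, u x = ⨆ M : ℕ, min (u x) M := fun x => by
    have h := inf_iSup_eq (u x) fun M : ℕ => (M : ℝ≥0∞)
    rw [ENNReal.iSup_natCast] at h
    simpa using h
  calc (∫⁻ x, u x ∂μ) ^ r = (∫⁻ x, ⨆ M : ℕ, min (u x) M ∂μ) ^ r := by simp_rw [← hsup]
    _ = (⨆ M : ℕ, ∫⁻ x, min (u x) M ∂μ) ^ r := by
      rw [lintegral_iSup fun M => hu.min measurable_const]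
      exact fun M N hMN x => min_le_min_left _ (by exact_mod_cast hMN)
    _ = _ := (ENNReal.orderIsoRpow r hr).map_iSup _

lemma isPrekopaLeindler_volume_real : IsPrekopaLeindler (volume : Measure ℝ) := by
  intro l hl₀ hl₁ f g h hf hg hh H
  rw [lintegral_rpow_eq_iSup_min_natCast _ hf (sub_pos.2 hl₁),
    lintegral_rpow_eq_iSup_min_natCast _ hg hl₀, ENNReal.iSup_mul]
  refine iSup_le fun M => ?_
  rw [ENNReal.mul_iSup]
  refine iSup_le fun N => prekopa_leindler_real_of_bounded (hf.min measurable_const)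
    (hg.min measurable_const) hh hl₀ hl₁ ?_ ?_ fun x y => le_trans ?_ (H x y)
  · exact ne_top_of_le_ne_top (ENNReal.natCast_ne_top M) (iSup_le fun _ => min_le_right _ _)
  · exact ne_top_of_le_ne_top (ENNReal.natCast_ne_top N) (iSup_le fun _ => min_le_right _ _)
  · have := sub_pos.2 hl₁
    gcongr <;> exact min_le_left _ _

end Real

namespace IsPrekopaLeindler

variable {E F : Type*} [AddCommGroup E] [Module ℝ E] [MeasurableSpace E]
  [AddCommGroup F] [Module ℝ F] [MeasurableSpace F] {μ : Measure E} {ν : Measure F}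

lemma prod [SFinite ν] (hμ : IsPrekopaLeindler μ) (hν : IsPrekopaLeindler ν) :
    IsPrekopaLeindler (μ.prod ν) := by
  intro l hl₀ hl₁ f g h hf hg hh H
  rw [lintegral_prod _ hf.aemeasurable, lintegral_prod _ hg.aemeasurable,
    lintegral_prod _ hh.aemeasurable]
  exact hμ hl₀ hl₁ hf.lintegral_prod_right' hg.lintegral_prod_right' hh.lintegral_prod_right'
    fun x y => hν hl₀ hl₁ (hf.comp measurable_prodMk_left) (hg.comp measurable_prodMk_left)
      (hh.comp measurable_prodMk_left) fun x' y' => H (x, x') (y, y')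

lemma map (hμ : IsPrekopaLeindler μ) (e : E →ₗ[ℝ] F) (he : Measurable e) :
    IsPrekopaLeindler (μ.map e) := by
  intro l hl₀ hl₁ f g h hf hg hh H
  rw [lintegral_map hf he, lintegral_map hg he, lintegral_map hh he]
  refine hμ hl₀ hl₁ (hf.comp he) (hg.comp he) (hh.comp he) fun x y => ?_
  simpa only [map_add, map_smul] using H (e x) (e y)

lemma measure_rpow_mul_rpow_le (hμ : IsPrekopaLeindler μ) {A B C : Set E} (hA : MeasurableSet A)
    (hB : MeasurableSet B) (hC : MeasurableSet C) {l : ℝ} (hl₀ : 0 < l) (hl₁ : l < 1)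
    (H : ∀ x ∈ A, ∀ y ∈ B, (1 - l) • x + l • y ∈ C) :
    μ A ^ (1 - l) * μ B ^ l ≤ μ C := by
  simp only [← lintegral_indicator_one hA, ← lintegral_indicator_one hB,
    ← lintegral_indicator_one hC]
  refine hμ hl₀ hl₁ (measurable_one.indicator hA) (measurable_one.indicator hB)
    (measurable_one.indicator hC) fun x y => ?_
  by_cases hx : x ∈ A
  · by_cases hy : y ∈ B
    · simp [hx, hy, H x hx y hy]
    · simp [hy, hl₀]
  · simp [hx, hl₁]

end IsPrekopaLeindler

lemma isPrekopaLeindler_volume_pi (d : ℕ) : IsPrekopaLeindler (volume : Measure (Fin d → ℝ)) := by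
  induction d with
  | zero =>
    intro l _ _ f g h _ _ _ H
    rw [lintegral_unique, lintegral_unique, lintegral_unique]
    simpa only [volume_pi, Measure.pi_empty_univ, mul_one, Subsingleton.elim _ default] using
      H default default
  | succ d ih =>
    let e : (ℝ × (Fin d → ℝ)) →ₗ[ℝ] Fin (d + 1) → ℝ :=
      (Fin.consLinearEquiv ℝ fun _ : Fin (d + 1) => ℝ).toLinearMap
    have he : MeasurePreserving e := by
      convert (volume_preserving_piFinSuccAbove (fun _ : Fin (d + 1) => ℝ) 0).symm using 1
      exact funext fun x => (Fin.insertNth_zero' _ _).symm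
    rw [← he.map_eq]
    exact (isPrekopaLeindler_volume_real.prod ih).map e he.measurable

lemma ofReal_weighted_pow_le_volume {d : ℕ} {A B C : Set (Fin d → ℝ)} (hA : MeasurableSet A)
    (hB : MeasurableSet B) (hC : MeasurableSet C) {l a b : ℝ} (hl₀ : 0 < l) (hl₁ : l < 1)
    (ha : 0 < a) (hb : 0 < b) (hAa : volume A = ENNReal.ofReal (a ^ d))
    (hBb : volume B = ENNReal.ofReal (b ^ d))
    (H : ∀ x ∈ A, ∀ y ∈ B, (1 - l) • x + l • y ∈ C) :
    ENNReal.ofReal (((1 - l) * a + l * b) ^ d) ≤ volume C := by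
  have hl : 0 < 1 - l := sub_pos.2 hl₁
  set c := (1 - l) * a + l * b with hc
  have hc₀ : 0 < c := by positivity
  have volume_inv_smul : ∀ {S : Set (Fin d → ℝ)} {r : ℝ}, 0 < r →
      volume (r⁻¹ • S) = (ENNReal.ofReal (r ^ d))⁻¹ * volume S := fun {S r} hr => by
    rw [Measure.addHaar_smul, Module.finrank_fintype_fun_eq_card, Fintype.card_fin,
      abs_of_pos (by positivity), inv_pow, ENNReal.ofReal_inv_of_pos (by positivity)]
  have inv_mul_self : ∀ {r : ℝ}, 0 < r →
      (ENNReal.ofReal (r ^ d))⁻¹ * ENNReal.ofReal (r ^ d) = 1 := fun hr =>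
    ENNReal.inv_mul_cancel (by simpa using pow_pos hr d) ENNReal.ofReal_ne_top
  -- After normalizing `A` and `B` to unit volume, `c⁻¹ • C` carries the weight `l * b / c`.
  have hunit := (isPrekopaLeindler_volume_pi d).measure_rpow_mul_rpow_le (l := l * b / c)
    (hA.const_smul₀ a⁻¹) (hB.const_smul₀ b⁻¹) (hC.const_smul₀ c⁻¹) (by positivity)
    (by rw [div_lt_one hc₀, hc]; linarith [mul_pos hl ha]) (by
      rintro _ ⟨x, hx, rfl⟩ _ ⟨y, hy, rfl⟩
      refine ⟨_, H x hx y hy, ?_⟩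
      have hsub : 1 - l * b / c = (1 - l) * a / c := by field_simp; rw [hc]; ring
      simp only [hsub, smul_add, smul_smul]
      congr 2 <;> field_simp)
  rw [volume_inv_smul ha, volume_inv_smul hb, volume_inv_smul hc₀, hAa, hBb, inv_mul_self ha,
    inv_mul_self hb, ENNReal.one_rpow, ENNReal.one_rpow, one_mul, mul_comm,
    ← div_eq_mul_inv] at hunit
  simpa using (ENNReal.le_div_iff_mul_le (Or.inl (by simpa using pow_pos hc₀ d))
    (Or.inl ENNReal.ofReal_ne_top)).1 hunit

theorem brunn_minkowski {d : ℕ} {A B C : Set (Fin d → ℝ)} (hd : d ≠ 0) (hA : MeasurableSet A)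
    (hB : MeasurableSet B) (hC : MeasurableSet C) (hA₀ : volume A ≠ 0) (hB₀ : volume B ≠ 0)
    {l : ℝ} (hl₀ : 0 < l) (hl₁ : l < 1) (H : ∀ x ∈ A, ∀ y ∈ B, (1 - l) • x + l • y ∈ C) :
    ENNReal.ofReal (1 - l) * volume A ^ (d : ℝ)⁻¹ + ENNReal.ofReal l * volume B ^ (d : ℝ)⁻¹ ≤
      volume C ^ (d : ℝ)⁻¹ := by
  have hd₀ : 0 < (d : ℝ)⁻¹ := by positivity
  have hl : 0 < 1 - l := sub_pos.2 hl₁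
  have hmul := (isPrekopaLeindler_volume_pi d).measure_rpow_mul_rpow_le hA hB hC hl₀ hl₁ H
  rcases eq_or_ne (volume C) ⊤ with hC_top | hC_top
  · simp [hC_top, hd₀]
  have hA_top : volume A ≠ ⊤ := fun h => by
    rw [h, ENNReal.top_rpow_of_pos hl, ENNReal.top_mul (by simp [hB₀, hl₀, hl₀.le])] at hmul
    exact hC_top (top_le_iff.1 hmul)
  have hB_top : volume B ≠ ⊤ := fun h => by
    rw [h, ENNReal.top_rpow_of_pos hl₀, ENNReal.mul_top (by simp [hA₀, hl, hl₁.le])] at hmul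
    exact hC_top (top_le_iff.1 hmul)
  have root : ∀ {v : ℝ≥0∞}, v ≠ 0 → v ≠ ⊤ → 0 < (v ^ (d : ℝ)⁻¹).toReal ∧
      v = ENNReal.ofReal ((v ^ (d : ℝ)⁻¹).toReal ^ d) ∧
      v ^ (d : ℝ)⁻¹ = ENNReal.ofReal (v ^ (d : ℝ)⁻¹).toReal := fun {v} hv₀ hv => by
    have hv' := ENNReal.rpow_ne_top_of_nonneg hd₀.le hv
    refine ⟨ENNReal.toReal_pos (by simp [hv₀, hv]) hv', ?_, (ENNReal.ofReal_toReal hv').symm⟩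
    rw [ENNReal.ofReal_pow ENNReal.toReal_nonneg, ENNReal.ofReal_toReal hv',
      ENNReal.rpow_inv_natCast_pow hd]
  obtain ⟨ha, hAa, ha'⟩ := root hA₀ hA_top
  obtain ⟨hb, hBb, hb'⟩ := root hB₀ hB_top
  have hle := ofReal_weighted_pow_le_volume hA hB hC hl₀ hl₁ ha hb hAa hBb H
  rw [ENNReal.ofReal_pow (by positivity)] at hle
  rw [ha', hb', ← ENNReal.ofReal_mul hl.le, ← ENNReal.ofReal_mul hl₀.le,
    ← ENNReal.ofReal_add (by positivity) (by positivity),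
    ← ENNReal.pow_rpow_inv_natCast hd (ENNReal.ofReal _)]
  gcongr

end BrunnMinkowski

section TailIntegrals

open Set Filter

lemma integrable_mul_of_hasCompactSupport {f g : ℝ → ℝ} (hg : Continuous g) (hf : Integrable f)
    (hf' : HasCompactSupport f) : Integrable fun t => g t * f t :=
  (integrableOn_iff_integrable_of_support_subset ((Function.support_mul_subset_right g f).trans
    subset_closure)).1 (hf.integrableOn.continuousOn_mul hg.continuousOn hf')

/-- The tail integral `z ↦ ∫_{t > z} f t`. -/
noncomputable def tailIntegral (f : ℝ → ℝ) (z : ℝ) : ℝ := ∫ t in Ioi z, f t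

/-- The `p`-th moment `∫_{t > 0} tᵖ f t` of the restriction of `f` to the positive half-line. -/
noncomputable def posMoment (p : ℝ) (f : ℝ → ℝ) : ℝ := ∫ t in Ioi 0, t ^ p * f t

variable {f : ℝ → ℝ} {p : ℝ}

lemma tailIntegral_neg (f : ℝ → ℝ) : tailIntegral (-f) = -tailIntegral f :=
  funext fun _ => integral_neg f

lemma tailIntegral_sub_tailIntegral (hf : Integrable f) (a b : ℝ) :
    tailIntegral f a - tailIntegral f b = ∫ t in a..b, f t :=
  (intervalIntegral.integral_Ioi_sub_Ioi' hf.integrableOn hf.integrableOn)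

lemma tailIntegral_eq_sub_intervalIntegral (hf : Integrable f) (z : ℝ) :
    tailIntegral f z = tailIntegral f 0 - ∫ t in 0..z, f t := by
  rw [← tailIntegral_sub_tailIntegral hf, sub_sub_cancel]

lemma continuous_tailIntegral (hf : Integrable f) : Continuous (tailIntegral f) := by
  rw [funext (tailIntegral_eq_sub_intervalIntegral hf)]
  exact continuous_const.sub
    (intervalIntegral.continuous_primitive (fun _ _ => hf.intervalIntegrable) 0)

lemma hasDerivAt_tailIntegral (hf : Integrable f) (hc : Continuous f) (z : ℝ) :
    HasDerivAt (tailIntegral f) (-f z) z := by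
  rw [funext (tailIntegral_eq_sub_intervalIntegral hf)]
  exact (intervalIntegral.integral_hasDerivAt_right hf.intervalIntegrable
    (hc.stronglyMeasurableAtFilter _ _) hc.continuousAt).const_sub _

lemma tailIntegral_comp_neg (hf : Integrable f) (h₀ : ∫ t, f t = 0) (z : ℝ) :
    tailIntegral (fun t => f (-t)) z = -tailIntegral f (-z) := by
  have hsplit := intervalIntegral.integral_Iic_add_Ioi (b := -z) hf.integrableOn hf.integrableOn
  rw [tailIntegral, integral_comp_neg_Ioi, tailIntegral]
  linarith

lemma hasCompactSupport_tailIntegral (hf : Integrable f) (hf' : HasCompactSupport f)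
    (h₀ : ∫ t, f t = 0) : HasCompactSupport (tailIntegral f) := by
  obtain ⟨R, -, hR⟩ := hf'.exists_pos_le_norm
  have vanish : ∀ {g : ℝ → ℝ} {z : ℝ}, (∀ t, R ≤ ‖t‖ → g t = 0) → R ≤ z → tailIntegral g z = 0 :=
    fun hg hz => setIntegral_eq_zero_of_forall_eq_zero fun t ht =>
      hg t ((hz.trans (le_of_lt ht)).trans (le_abs_self t))
  refine HasCompactSupport.intro (isCompact_Icc (a := -R) (b := R)) fun z hz => ?_
  rcases not_and_or.1 hz with hz | hz
  · rw [← neg_neg z, ← neg_eq_zero, ← tailIntegral_comp_neg hf h₀]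
    exact vanish (fun t ht => hR _ (by rwa [norm_neg])) (by linarith)
  · exact vanish hR (by linarith)

lemma posMoment_neg (p : ℝ) (f : ℝ → ℝ) : posMoment p (-f) = -posMoment p f := by
  simp only [posMoment, Pi.neg_apply, mul_neg, integral_neg]

lemma posMoment_comp_neg (p : ℝ) (f : ℝ → ℝ) :
    posMoment p (fun t => f (-t)) = ∫ t in Iic 0, (-t) ^ p * f t := by
  simpa [posMoment] using integral_comp_neg_Ioi 0 fun t => (-t) ^ p * f t

lemma integral_eq_posMoment_add (hf : Integrable f) :
    ∫ t, f t = posMoment 0 f + posMoment 0 fun t => f (-t) := by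
  rw [posMoment_comp_neg, ← intervalIntegral.integral_Iic_add_Ioi (b := 0) hf.integrableOn
    hf.integrableOn]
  simp only [posMoment, Real.rpow_zero, one_mul, add_comm]

lemma integral_mul_eq_posMoment_sub (hf : Integrable f) (hf' : HasCompactSupport f) :
    ∫ t, t * f t = posMoment 1 f - posMoment 1 fun t => f (-t) := by
  have hint := integrable_mul_of_hasCompactSupport continuous_id' hf hf'
  rw [posMoment_comp_neg, ← intervalIntegral.integral_Iic_add_Ioi (b := 0) hint.integrableOn
    hint.integrableOn]
  simp only [posMoment, Real.rpow_one, neg_mul, integral_neg]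
  ring

lemma integral_integral_kernel_mul {α β : Type*} [MeasurableSpace α] [MeasurableSpace β]
    {μ : Measure α} {ν : Measure β} [SFinite μ] [SFinite ν] {κ : α → β → ℝ} {f : β → ℝ}
    (hκ : Measurable (Function.uncurry κ)) (hκ₀ : ∀ᵐ x ∂μ, ∀ t, 0 ≤ κ x t)
    (hκ₁ : ∀ᵐ t ∂ν, Integrable (fun x => κ x t) μ) (hf : AEStronglyMeasurable f ν)
    (hint : Integrable (fun t => (∫ x, κ x t ∂μ) * f t) ν) :
    ∫ x, ∫ t, κ x t * f t ∂ν ∂μ = ∫ t, (∫ x, κ x t ∂μ) * f t ∂ν := by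
  have hprod : Integrable (fun z : α × β => κ z.1 z.2 * f z.2) (μ.prod ν) := by
    refine (integrable_prod_iff' (hκ.aestronglyMeasurable.mul hf.comp_snd)).2
      ⟨hκ₁.mono fun t ht => by exact ht.mul_const (f t), hint.norm.congr (.of_forall fun t => ?_)⟩
    have hκ_norm : ∀ᵐ x ∂μ, ‖κ x t * f t‖ = κ x t * ‖f t‖ :=
      hκ₀.mono fun x hx => by rw [norm_mul, Real.norm_of_nonneg (hx t)]
    have hκ_int : 0 ≤ ∫ x, κ x t ∂μ := integral_nonneg_of_ae (hκ₀.mono fun x hx => hx t)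
    exact (by rw [norm_mul, Real.norm_of_nonneg hκ_int, integral_congr_ae hκ_norm,
      integral_mul_const] : ‖(∫ x, κ x t ∂μ) * f t‖ = ∫ x, ‖κ x t * f t‖ ∂μ)
  rw [integral_integral_swap hprod]
  simp only [integral_mul_const]

lemma posMoment_tailIntegral (hp : -1 < p) (hf : Integrable f) (hf' : HasCompactSupport f) :
    posMoment p (tailIntegral f) = posMoment (p + 1) f / (p + 1) := by
  have hp₁ : 0 < p + 1 := by linarith
  let κ : ℝ → ℝ → ℝ := fun x t => (Iio t).indicator (fun x => x ^ p) x
  have hκ : Measurable (Function.uncurry κ) :=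
    (measurable_fst.pow_const p).indicator (measurableSet_lt measurable_fst measurable_snd)
  have integrable_κ : ∀ t : ℝ, IntegrableOn (fun x => κ x t) (Ioi 0) := fun t => by
    rw [IntegrableOn, integrable_indicator_iff measurableSet_Iio, IntegrableOn,
      Measure.restrict_restrict measurableSet_Iio, Iio_inter_Ioi]
    exact IntegrableOn.mono_set
      (intervalIntegral.intervalIntegrable_rpow' hp : IntervalIntegrable _ volume 0 t).1
      Ioo_subset_Ioc_self
  have integral_κ : ∀ t > 0, ∫ x in Ioi 0, κ x t = t ^ (p + 1) / (p + 1) := fun t ht => by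
    rw [setIntegral_indicator measurableSet_Iio, Ioi_inter_Iio, ← integral_Ioc_eq_integral_Ioo,
      ← intervalIntegral.integral_of_le ht.le, integral_rpow (Or.inl hp),
      Real.zero_rpow hp₁.ne', sub_zero]
  have integral_κ_mul : EqOn (fun t => (∫ x in Ioi 0, κ x t) * f t)
      (fun t => t ^ (p + 1) * f t / (p + 1)) (Ioi 0) := fun t ht => by
    simp only [integral_κ t ht]; ring
  calc posMoment p (tailIntegral f) = ∫ x in Ioi 0, ∫ t in Ioi 0, κ x t * f t := by
        refine setIntegral_congr_fun measurableSet_Ioi fun x hx => ?_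
        have hκ_mul : ∀ t, κ x t * f t = (Ioi x).indicator (fun t => x ^ p * f t) t := fun t => by
          by_cases hxt : x < t <;> simp [κ, hxt]
        simp only [hκ_mul, tailIntegral]
        rw [setIntegral_indicator measurableSet_Ioi, Ioi_inter_Ioi, sup_eq_right.2 (le_of_lt hx),
          integral_const_mul]
    _ = ∫ t in Ioi 0, (∫ x in Ioi 0, κ x t) * f t := by
        refine integral_integral_kernel_mul hκ ?_ ?_ hf.aestronglyMeasurable.restrict ?_
        · exact ae_restrict_of_forall_mem measurableSet_Ioi fun x hx t =>
            indicator_apply_nonneg fun _ => (Real.rpow_nonneg (le_of_lt hx) p)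
        · exact .of_forall integrable_κ
        · refine IntegrableOn.congr_fun (Integrable.integrableOn ?_) integral_κ_mul.symm
            measurableSet_Ioi
          exact (integrable_mul_of_hasCompactSupport (Real.continuous_rpow_const hp₁.le)
            hf hf').div_const _
    _ = ∫ t in Ioi 0, t ^ (p + 1) * f t / (p + 1) :=
        setIntegral_congr_fun measurableSet_Ioi integral_κ_mul
    _ = posMoment (p + 1) f / (p + 1) := integral_div _ _

lemma integral_tailIntegral (hf : Integrable f) (hf' : HasCompactSupport f)
    (h₀ : ∫ t, f t = 0) : ∫ t, tailIntegral f t = ∫ t, t * f t := by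
  have hneg : (fun t => tailIntegral f (-t)) = -tailIntegral fun t => f (-t) :=
    funext fun t => by rw [Pi.neg_apply, tailIntegral_comp_neg hf h₀, neg_neg]
  have hcont := continuous_tailIntegral hf
  rw [integral_eq_posMoment_add
      (hcont.integrable_of_hasCompactSupport (hasCompactSupport_tailIntegral hf hf' h₀)),
    integral_mul_eq_posMoment_sub hf hf', hneg, posMoment_neg,
    posMoment_tailIntegral (by norm_num) hf hf',
    posMoment_tailIntegral (by norm_num) hf.comp_neg (hf'.comp_homeomorph (Homeomorph.neg ℝ))]
  norm_num [sub_eq_add_neg]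

end TailIntegrals

section SingleCrossing

open Set

lemma integrableOn_rpow_mul {p : ℝ} {G : ℝ → ℝ} (hp : -1 < p) (hG : Continuous G)
    (hG' : HasCompactSupport G) : IntegrableOn (fun t => t ^ p * G t) (Ioi 0) := by
  obtain ⟨R, -, hR⟩ := hG'.exists_pos_le_norm
  have hpow : IntegrableOn (fun t : ℝ => t ^ p) (Ioc 0 R) :=
    (intervalIntegral.intervalIntegrable_rpow' hp : IntervalIntegrable _ volume 0 R).1
  refine (hpow.mul_continuousOn_of_subset hG.continuousOn measurableSet_Ioc isCompact_Icc
    Ioc_subset_Icc_self).of_forall_sdiff_eq_zero measurableSet_Ioi fun t ht => ?_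
  have htR : R < t := by by_contra! h; exact ht.2 ⟨ht.1, h⟩
  rw [hR t (htR.le.trans (le_abs_self t)), mul_zero]

lemma eqOn_zero_of_setIntegral_eq_zero {X : Type*} [TopologicalSpace X] [MeasurableSpace X]
    [OpensMeasurableSpace X] {μ : Measure X} [μ.IsOpenPosMeasure] {U : Set X} {h : X → ℝ}
    (hU : IsOpen U) (hc : ContinuousOn h U) (h₀ : ∀ x ∈ U, 0 ≤ h x) (hint : IntegrableOn h U μ)
    (h₁ : ∫ x in U, h x ∂μ = 0) : EqOn h 0 U :=
  Measure.eqOn_open_of_ae_eq ((setIntegral_eq_zero_iff_of_nonneg_ae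
    (ae_restrict_of_forall_mem hU.measurableSet h₀) hint).1 h₁) hU hc continuousOn_const

lemma eqOn_zero_of_posMoment_eq_zero {p : ℝ} {G : ℝ → ℝ} (hp : -1 < p) (hG : Continuous G)
    (hG' : HasCompactSupport G) (h₀ : ∀ t > 0, 0 ≤ G t) (h : posMoment p G = 0) :
    EqOn G 0 (Ioi 0) := fun t (ht : 0 < t) => by
  have hc : ContinuousOn (fun t => t ^ p * G t) (Ioi 0) := fun t (ht : 0 < t) =>
    ((Real.continuousAt_rpow_const _ _ (Or.inl ht.ne')).mul hG.continuousAt).continuousWithinAt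
  have hzero := eqOn_zero_of_setIntegral_eq_zero isOpen_Ioi hc
    (fun t ht => mul_nonneg (Real.rpow_nonneg (le_of_lt ht) p) (h₀ t ht))
    (integrableOn_rpow_mul hp hG hG') h ht
  exact (mul_eq_zero.1 hzero).resolve_left (Real.rpow_pos_of_pos ht p).ne'

/-- `Alternates f n a`: to the right of `a` the function `f` takes `n` nonzero values of alternating
sign, the first of them positive. -/
def Alternates (f : ℝ → ℝ) : ℕ → ℝ → Prop
  | 0, _ => True
  | n + 1, a => ∃ x > a, 0 < f x ∧ Alternates (-f) n x

lemma Alternates.mono_left {n : ℕ} {f : ℝ → ℝ} {a b : ℝ} (h : Alternates f n b) (hab : a ≤ b) :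
    Alternates f n a := by
  cases n with
  | zero => trivial
  | succ n => exact let ⟨x, hx, hfx⟩ := h; ⟨x, hab.trans_lt hx, hfx⟩

lemma alternates_one_iff {f : ℝ → ℝ} {a : ℝ} : Alternates f 1 a ↔ ∃ x > a, 0 < f x := by
  simp [Alternates]

lemma alternates_two_iff {f : ℝ → ℝ} {a : ℝ} :
    Alternates f 2 a ↔ ∃ x > a, 0 < f x ∧ ∃ y > x, f y < 0 := by
  simp [Alternates]

lemma exists_crossing_of_not_alternates {G : ℝ → ℝ} (hG' : HasCompactSupport G)
    (hG_alt : ¬ Alternates G 2 0) :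
    ∃ y ≥ 0, (∀ t > 0, t < y → G t ≤ 0) ∧ ∀ t > 0, y < t → 0 ≤ G t := by
  simp only [alternates_two_iff, not_exists, not_and, not_lt] at hG_alt
  obtain ⟨R, hR₀, hR⟩ := hG'.exists_pos_le_norm
  let N := insert 0 {t | 0 < t ∧ G t < 0}
  have hN : BddAbove N := by
    refine ⟨R, ?_⟩
    rintro t (rfl | ⟨-, ht⟩)
    · exact hR₀.le
    · by_contra! htR
      exact ht.ne (hR t (htR.le.trans (le_abs_self t)))
  refine ⟨sSup N, le_csSup hN (mem_insert _ _), fun t ht hty => ?_, fun t ht hty => ?_⟩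
  · obtain ⟨z, hz, htz⟩ := exists_lt_of_lt_csSup (insert_nonempty _ _) hty
    rcases hz with rfl | ⟨-, hz⟩
    · exact absurd ht htz.not_gt
    · exact not_lt.1 fun hpos => (hG_alt t ht hpos z htz).not_gt hz
  · exact not_lt.1 fun hneg => hty.not_ge (le_csSup hN (mem_insert_of_mem _ ⟨ht, hneg⟩))

lemma posMoment_nonneg_of_not_alternates {p q : ℝ} {G : ℝ → ℝ} (hp : -1 < p) (hpq : p < q)
    (hG : Continuous G) (hG' : HasCompactSupport G) (hG_alt : ¬ Alternates G 2 0)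
    (h : posMoment p G = 0) :
    0 ≤ posMoment q G ∧ (posMoment q G = 0 → EqOn G 0 (Ioi 0)) := by
  obtain ⟨y, hy₀, hy_left, hy_right⟩ := exists_crossing_of_not_alternates hG' hG_alt
  have hpq' : 0 < q - p := sub_pos.2 hpq
  -- The moment of order `p` vanishes, so `t ^ q` may be replaced by `t ^ q - y ^ (q - p) * t ^ p`,
  -- which changes sign at `y` exactly as `G` does.
  let W : ℝ → ℝ := fun t => (t ^ (q - p) - y ^ (q - p)) * G t
  have hW : Continuous W :=
    ((Real.continuous_rpow_const hpq'.le).sub continuous_const).mul hG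
  have hW_nonneg : ∀ t > 0, 0 ≤ W t := fun t ht => by
    rcases lt_trichotomy t y with hty | rfl | hty
    · exact mul_nonneg_of_nonpos_of_nonpos
        (sub_nonpos.2 (Real.rpow_le_rpow ht.le hty.le hpq'.le)) (hy_left t ht hty)
    · simp [W]
    · exact mul_nonneg (sub_nonneg.2 (Real.rpow_le_rpow hy₀ hty.le hpq'.le)) (hy_right t ht hty)
  have hmoment : posMoment q G = posMoment p W := by
    have hsplit : EqOn (fun t => t ^ p * W t)
        (fun t => t ^ q * G t - y ^ (q - p) * (t ^ p * G t)) (Ioi 0) := fun t ht => by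
      simp only [W, Real.rpow_sub ht]
      field_simp [(Real.rpow_pos_of_pos ht p).ne']
    rw [posMoment, posMoment, setIntegral_congr_fun measurableSet_Ioi hsplit, integral_sub
      (integrableOn_rpow_mul (hp.trans hpq) hG hG') ((integrableOn_rpow_mul hp hG hG').const_mul _),
      integral_const_mul, ← posMoment, ← posMoment, h, mul_zero, sub_zero]
  refine ⟨hmoment ▸ setIntegral_nonneg measurableSet_Ioi fun t ht =>
    mul_nonneg (Real.rpow_nonneg (le_of_lt ht) p) (hW_nonneg t ht), fun hq => ?_⟩
  have hW_zero := eqOn_zero_of_posMoment_eq_zero hp hW hG'.mul_left hW_nonneg (hmoment ▸ hq)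
  refine Measure.eqOn_open_of_ae_eq (μ := volume) ?_ isOpen_Ioi hG.continuousOn continuousOn_const
  filter_upwards [ae_restrict_mem measurableSet_Ioi,
    ae_restrict_of_ae (Measure.ae_ne volume y)] with t ht hty
  refine (mul_eq_zero.1 (hW_zero ht)).resolve_left (sub_ne_zero.2 fun heq => hty ?_)
  exact (Real.rpow_left_inj (le_of_lt ht) hy₀ hpq'.ne').1 heq

end SingleCrossing

section Balanced

open Set

variable {D : ℝ → ℝ} {p q a : ℝ}

lemma exists_neg_of_tailIntegral_lt (hD : Integrable D) {b : ℝ} (hab : a < b)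
    (h : tailIntegral D a < tailIntegral D b) : ∃ t > a, t < b ∧ D t < 0 := by
  rw [← sub_neg, tailIntegral_sub_tailIntegral hD,
    intervalIntegral.integral_of_le hab.le, integral_Ioc_eq_integral_Ioo] at h
  by_contra! hnonneg
  exact h.not_ge (setIntegral_nonneg measurableSet_Ioo fun t ht => hnonneg t ht.1 ht.2)

lemma exists_pos_of_tailIntegral_pos (h : 0 < tailIntegral D a) : ∃ t > a, 0 < D t := by
  by_contra! hnonpos
  exact h.not_ge (setIntegral_nonpos measurableSet_Ioi hnonpos)

-- Rolle's theorem for a primitive vanishing at `+∞`: each sign change of the primitive, as well as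
-- its return to `0` at infinity, costs the integrand one more.
lemma Alternates.of_tailIntegral {n : ℕ} (hD : Integrable D) (ha : tailIntegral D a ≤ 0)
    (h : Alternates (tailIntegral D) (n + 1) a) : Alternates (-D) (n + 2) a := by
  induction n generalizing D a with
  | zero =>
    obtain ⟨x, hax, hx⟩ := alternates_one_iff.1 h
    obtain ⟨t, hat, htx, ht⟩ := exists_neg_of_tailIntegral_lt hD hax (ha.trans_lt hx)
    obtain ⟨y, hxy, hy⟩ := exists_pos_of_tailIntegral_pos hx
    exact alternates_two_iff.2 ⟨t, hat, neg_pos.2 ht, y, htx.trans hxy, neg_neg_iff_pos.2 hy⟩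
  | succ n ih =>
    obtain ⟨x, hax, hx, hnext⟩ := h
    obtain ⟨t, hat, htx, ht⟩ := exists_neg_of_tailIntegral_lt hD hax (ha.trans_lt hx)
    rw [← tailIntegral_neg] at hnext
    refine ⟨t, hat, neg_pos.2 ht, (ih hD.neg ?_ hnext).mono_left htx.le⟩
    simpa [tailIntegral_neg] using hx.le

/-- The stop-loss transform `z ↦ ∫ (t - z)₊ D t`, written as an iterated tail integral. -/
noncomputable def stopLoss (D : ℝ → ℝ) : ℝ → ℝ := tailIntegral (tailIntegral D)

/-- A compactly supported function with vanishing total integral and vanishing first moment, such as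
the difference of two centered densities. These are the conditions under which the stop-loss
transform is again compactly supported. -/
structure IsBalanced (D : ℝ → ℝ) : Prop where
  integrable : Integrable D
  hasCompactSupport : HasCompactSupport D
  integral_eq_zero : ∫ t, D t = 0
  integral_mul_eq_zero : ∫ t, t * D t = 0

lemma stopLoss_neg (D : ℝ → ℝ) : stopLoss (-D) = -stopLoss D := by
  simp only [stopLoss, tailIntegral_neg]

namespace IsBalanced

lemma neg (hD : IsBalanced D) : IsBalanced (-D) where
  integrable := hD.integrable.neg
  hasCompactSupport := hD.hasCompactSupport.neg
  integral_eq_zero := by simp [integral_neg, hD.integral_eq_zero]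
  integral_mul_eq_zero := by simp [integral_neg, hD.integral_mul_eq_zero]

lemma comp_neg (hD : IsBalanced D) : IsBalanced fun t => D (-t) where
  integrable := hD.integrable.comp_neg
  hasCompactSupport := hD.hasCompactSupport.comp_homeomorph (Homeomorph.neg ℝ)
  integral_eq_zero := by rw [integral_neg_eq_self D, hD.integral_eq_zero]
  integral_mul_eq_zero := by
    simpa [integral_neg, hD.integral_mul_eq_zero] using
      integral_neg_eq_self (fun t => -t * D t) volume

lemma continuous_tailIntegral (hD : IsBalanced D) : Continuous (tailIntegral D) :=
  _root_.continuous_tailIntegral hD.integrable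

lemma hasCompactSupport_tailIntegral (hD : IsBalanced D) : HasCompactSupport (tailIntegral D) :=
  _root_.hasCompactSupport_tailIntegral hD.integrable hD.hasCompactSupport hD.integral_eq_zero

lemma integrable_tailIntegral (hD : IsBalanced D) : Integrable (tailIntegral D) :=
  hD.continuous_tailIntegral.integrable_of_hasCompactSupport hD.hasCompactSupport_tailIntegral

lemma integral_tailIntegral (hD : IsBalanced D) : ∫ t, tailIntegral D t = 0 := by
  rw [_root_.integral_tailIntegral hD.integrable hD.hasCompactSupport hD.integral_eq_zero,
    hD.integral_mul_eq_zero]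

lemma continuous_stopLoss (hD : IsBalanced D) : Continuous (stopLoss D) :=
  _root_.continuous_tailIntegral hD.integrable_tailIntegral

lemma hasCompactSupport_stopLoss (hD : IsBalanced D) : HasCompactSupport (stopLoss D) :=
  _root_.hasCompactSupport_tailIntegral hD.integrable_tailIntegral
    hD.hasCompactSupport_tailIntegral hD.integral_tailIntegral

lemma hasDerivAt_stopLoss (hD : IsBalanced D) (z : ℝ) :
    HasDerivAt (stopLoss D) (-tailIntegral D z) z :=
  hasDerivAt_tailIntegral hD.integrable_tailIntegral hD.continuous_tailIntegral z

lemma stopLoss_comp_neg (hD : IsBalanced D) (z : ℝ) :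
    stopLoss (fun t => D (-t)) z = stopLoss D (-z) := by
  have htail : tailIntegral (fun t => D (-t)) = -fun z => tailIntegral D (-z) :=
    funext (tailIntegral_comp_neg hD.integrable hD.integral_eq_zero)
  rw [stopLoss, htail, tailIntegral_neg, Pi.neg_apply,
    tailIntegral_comp_neg hD.integrable_tailIntegral hD.integral_tailIntegral, neg_neg, stopLoss]

lemma posMoment_stopLoss (hD : IsBalanced D) (hp : 1 < p) :
    posMoment (p - 2) (stopLoss D) = posMoment p D / (p * (p - 1)) := by
  rw [stopLoss, posMoment_tailIntegral (by linarith) hD.integrable_tailIntegral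
    hD.hasCompactSupport_tailIntegral, posMoment_tailIntegral (by linarith) hD.integrable
    hD.hasCompactSupport, div_div]
  ring_nf

lemma alternates_of_stopLoss {n : ℕ} (hD : IsBalanced D) (hT : tailIntegral D a = 0)
    (hS : stopLoss D a = 0) (h : Alternates (stopLoss D) (n + 1) a) : Alternates D (n + 3) a := by
  have hT_alt := Alternates.of_tailIntegral hD.integrable_tailIntegral hS.le h
  rw [← tailIntegral_neg] at hT_alt
  simpa using hT_alt.of_tailIntegral hD.integrable.neg (by simp [tailIntegral_neg, hT])

lemma exists_alternates_of_stopLoss {n : ℕ} (hD : IsBalanced D)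
    (h : Alternates (stopLoss D) (n + 1) a) : ∃ b, Alternates D (n + 3) b := by
  obtain ⟨R, -, hR⟩ := hD.hasCompactSupport_stopLoss.exists_pos_le_norm
  obtain ⟨R', -, hR'⟩ := hD.hasCompactSupport_tailIntegral.exists_pos_le_norm
  let b := -max |a| (max R R')
  have hb : |b| = max |a| (max R R') := by
    rw [abs_neg, abs_of_nonneg ((abs_nonneg a).trans (le_max_left _ _))]
  refine ⟨b, hD.alternates_of_stopLoss (hR' b ?_) (hR b ?_) (h.mono_left ?_)⟩
  · rw [Real.norm_eq_abs, hb]; simp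
  · rw [Real.norm_eq_abs, hb]; simp
  · exact neg_le.2 ((neg_le_abs a).trans (le_max_left _ _))

lemma stopLoss_eq_zero_of_nonneg (hD : IsBalanced D) (hp : 1 < p)
    (hmoment : posMoment p (fun t => D (-t)) = 0) (h : ∀ z < 0, 0 ≤ stopLoss D z) :
    stopLoss D 0 = 0 ∧ tailIntegral D 0 = 0 := by
  have hzero : EqOn (stopLoss fun t => D (-t)) 0 (Ioi 0) := by
    refine eqOn_zero_of_posMoment_eq_zero (p := p - 2) (by linarith) hD.comp_neg.continuous_stopLoss
      hD.comp_neg.hasCompactSupport_stopLoss (fun t ht => ?_) ?_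
    · rw [hD.stopLoss_comp_neg]; exact h (-t) (neg_neg_of_pos ht)
    · rw [hD.comp_neg.posMoment_stopLoss hp, hmoment, zero_div]
  have hzero' : EqOn (stopLoss D) 0 (Iic 0) := by
    rw [← closure_Iio]
    refine EqOn.closure (fun z (hz : z < 0) => ?_) hD.continuous_stopLoss continuous_const
    simpa [hD.stopLoss_comp_neg] using hzero (neg_pos.2 hz)
  have hderiv : HasDerivWithinAt (stopLoss D) 0 (Iic 0) 0 :=
    (hasDerivWithinAt_const 0 _ 0).congr hzero' (hzero' self_mem_Iic)
  refine ⟨hzero' self_mem_Iic, neg_eq_zero.1 ?_⟩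
  exact (uniqueDiffWithinAt_Iic 0).eq_deriv _ (hD.hasDerivAt_stopLoss 0).hasDerivWithinAt hderiv

lemma tailIntegral_eq_zero_of_stopLoss_eq_zero (hD : IsBalanced D) (h : stopLoss D = 0) :
    tailIntegral D = 0 := funext fun z => neg_eq_zero.1 <|
  (hD.hasDerivAt_stopLoss z).unique (h ▸ hasDerivAt_const z 0)

theorem posMoment_nonneg (hD : IsBalanced D) (hp : 1 < p) (hpq : p < q)
    (h : posMoment p D = 0) (h' : posMoment p (fun t => D (-t)) = 0)
    (h_alt : ∀ a, ¬ Alternates (-D) 5 a) (h_alt_zero : ¬ Alternates D 4 0) :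
    0 ≤ posMoment q D ∧ (posMoment q D = 0 → EqOn (stopLoss D) 0 (Ici 0)) := by
  have hS_alt : ¬ Alternates (stopLoss D) 2 0 := fun hS => by
    by_cases hneg : ∃ z < 0, stopLoss D z < 0
    · obtain ⟨z, hz₀, hz⟩ := hneg
      have hz_alt : Alternates (stopLoss (-D)) 3 (z - 1) :=
        ⟨z, by simp, by simpa [stopLoss_neg] using hz, by
          rw [stopLoss_neg, neg_neg]; exact hS.mono_left hz₀.le⟩
      obtain ⟨b, hb⟩ := hD.neg.exists_alternates_of_stopLoss hz_alt
      exact h_alt b hb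
    · obtain ⟨hS₀, hT₀⟩ := hD.stopLoss_eq_zero_of_nonneg hp h' (by push Not at hneg; exact hneg)
      exact h_alt_zero (hD.alternates_of_stopLoss hT₀ hS₀ hS)
  have hq : 1 < q := hp.trans hpq
  have hq' : 0 < q * (q - 1) := mul_pos (by linarith) (by linarith)
  obtain ⟨hnonneg, hzero⟩ := posMoment_nonneg_of_not_alternates (p := p - 2) (q := q - 2)
    (by linarith) (by linarith) hD.continuous_stopLoss hD.hasCompactSupport_stopLoss hS_alt
    (by rw [hD.posMoment_stopLoss hp, h, zero_div])
  rw [hD.posMoment_stopLoss hq] at hnonneg hzero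
  refine ⟨by simpa using (le_div_iff₀ hq').1 hnonneg, fun h₀ => ?_⟩
  rw [← closure_Ioi]
  exact (hzero (by rw [h₀, zero_div])).closure hD.continuous_stopLoss continuous_const

theorem posMoment_nonpos (hD : IsBalanced D) (hp : 1 < p)
    (h : posMoment p (fun t => D (-t)) = 0) (h_alt : ∀ a, ¬ Alternates (-D) 4 a)
    (h_alt_zero : ¬ Alternates D 3 0) : posMoment p D ≤ 0 := by
  have hS : ∀ x > 0, stopLoss D x ≤ 0 := fun x hx => not_lt.1 fun hSx => by
    by_cases hneg : ∃ z < 0, stopLoss D z < 0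
    · obtain ⟨z, hz₀, hz⟩ := hneg
      have hz_alt : Alternates (stopLoss (-D)) 2 (z - 1) := by
        rw [stopLoss_neg]
        exact alternates_two_iff.2
          ⟨z, by simp, neg_pos.2 hz, x, hz₀.trans hx, neg_neg_iff_pos.2 hSx⟩
      obtain ⟨b, hb⟩ := hD.neg.exists_alternates_of_stopLoss hz_alt
      exact h_alt b hb
    · obtain ⟨hS₀, hT₀⟩ := hD.stopLoss_eq_zero_of_nonneg hp h (by push Not at hneg; exact hneg)
      exact h_alt_zero (hD.alternates_of_stopLoss hT₀ hS₀ (alternates_one_iff.2 ⟨x, hx, hSx⟩))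
  have hmoment : posMoment (p - 2) (stopLoss D) ≤ 0 :=
    setIntegral_nonpos measurableSet_Ioi fun t ht =>
      mul_nonpos_of_nonneg_of_nonpos (Real.rpow_nonneg (le_of_lt ht) _) (hS t ht)
  rw [hD.posMoment_stopLoss hp] at hmoment
  simpa using (div_le_iff₀ (mul_pos (by linarith) (by linarith))).1 hmoment

end IsBalanced

end Balanced

section PowDensity

open Set

lemma Alternates.mono_sign {f g : ℝ → ℝ} (hpos : ∀ x, 0 < f x → 0 < g x)
    (hneg : ∀ x, f x < 0 → g x < 0) {n : ℕ} {a : ℝ} (h : Alternates f n a) : Alternates g n a := by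
  induction n generalizing f g a with
  | zero => trivial
  | succ n ih =>
    obtain ⟨x, hax, hx, hnext⟩ := h
    exact ⟨x, hax, hpos x hx, ih (by simpa using hneg) (by simpa using hpos) hnext⟩

lemma posMoment_sub {p : ℝ} {f g : ℝ → ℝ} (hf : IntegrableOn (fun t => t ^ p * f t) (Ioi 0))
    (hg : IntegrableOn (fun t => t ^ p * g t) (Ioi 0)) :
    posMoment p (fun t => f t - g t) = posMoment p f - posMoment p g := by
  simp only [posMoment, mul_sub]
  exact integral_sub hf hg

lemma ae_eq_zero_of_posMoment_eq_zero {p : ℝ} {f : ℝ → ℝ} (h₀ : ∀ t > 0, 0 ≤ f t)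
    (hint : IntegrableOn (fun t => t ^ p * f t) (Ioi 0)) (h : posMoment p f = 0) :
    f =ᵐ[volume.restrict (Ioi 0)] 0 := by
  have hzero := (setIntegral_eq_zero_iff_of_nonneg_ae (ae_restrict_of_forall_mem measurableSet_Ioi
    fun t ht => mul_nonneg (Real.rpow_nonneg (le_of_lt ht) p) (h₀ t ht)) hint).1 h
  filter_upwards [hzero, ae_restrict_mem measurableSet_Ioi] with t ht ht₀
  exact (mul_eq_zero.1 ht).resolve_left (Real.rpow_pos_of_pos ht₀ p).ne'

lemma posMoment_eq_zero_of_ae {f : ℝ → ℝ} (h : f =ᵐ[volume.restrict (Ioi 0)] 0) (p : ℝ) :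
    posMoment p f = 0 :=
  integral_eq_zero_of_ae (h.mono fun t ht => by simp [ht])

/-- `φ` is concave on the set where it is positive, which is itself convex. -/
def ConcaveOnPos (φ : ℝ → ℝ) : Prop :=
  ∀ x z, 0 < φ x → 0 < φ z → ∀ l, 0 < l → l < 1 → (1 - l) * φ x + l * φ z ≤ φ ((1 - l) * x + l * z)

namespace ConcaveOnPos

variable {φ γ : ℝ → ℝ}

lemma comp_neg (hφ : ConcaveOnPos φ) : ConcaveOnPos fun t => φ (-t) := by
  intro x z hx hz l hl₀ hl₁
  convert hφ (-x) (-z) hx hz l hl₀ hl₁ using 2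
  ring

lemma le_of_convexOn (hφ : ConcaveOnPos φ) {s : Set ℝ} (hγ : ConvexOn ℝ s γ) {x y z : ℝ}
    (hxs : x ∈ s) (hzs : z ∈ s) (hxy : x < y) (hyz : y < z) (hx : 0 < φ x) (hz : 0 < φ z)
    (hγx : γ x ≤ φ x) (hγz : γ z ≤ φ z) : γ y ≤ φ y := by
  obtain ⟨a, l, ha, hl, hal, rfl⟩ := (Ioo_subset_openSegment (𝕜 := ℝ)) ⟨hxy, hyz⟩
  obtain rfl : a = 1 - l := eq_sub_of_add_eq hal
  calc γ ((1 - l) • x + l • z) ≤ (1 - l) • γ x + l • γ z := hγ.2 hxs hzs ha.le hl.le hal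
    _ ≤ (1 - l) * φ x + l * φ z := by simp only [smul_eq_mul]; gcongr
    _ ≤ φ ((1 - l) • x + l • z) := hφ x z hx hz l hl (sub_pos.1 ha)

end ConcaveOnPos

/-- `φ ^ k` is a compactly supported probability density with mean zero. By the Brunn–Minkowski
inequality the marginals of a centered convex body of dimension `k + 1` have such densities with
`φ` concave on its support, and working with the root `φ` makes this concavity available. -/
structure IsCenteredPowDensity (k : ℕ) (φ : ℝ → ℝ) : Prop where
  ne_zero : k ≠ 0
  nonneg : ∀ t, 0 ≤ φ t
  hasCompactSupport : HasCompactSupport φ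
  integrable : Integrable fun t => φ t ^ k
  integral_eq : ∫ t, φ t ^ k = 1
  mean_eq : ∫ t, t * φ t ^ k = 0

namespace IsCenteredPowDensity

variable {k : ℕ} {φ γ : ℝ → ℝ} {p q m : ℝ}

lemma comp_neg (hφ : IsCenteredPowDensity k φ) : IsCenteredPowDensity k fun t => φ (-t) where
  ne_zero := hφ.ne_zero
  nonneg t := hφ.nonneg _
  hasCompactSupport := hφ.hasCompactSupport.comp_homeomorph (Homeomorph.neg ℝ)
  integrable := hφ.integrable.comp_neg
  integral_eq := by rw [integral_neg_eq_self (fun t => φ t ^ k), hφ.integral_eq]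
  mean_eq := by
    simpa [integral_neg, hφ.mean_eq] using integral_neg_eq_self (fun t => -t * φ t ^ k) volume

lemma hasCompactSupport_pow (hφ : IsCenteredPowDensity k φ) :
    HasCompactSupport fun t => φ t ^ k :=
  hφ.hasCompactSupport.comp_left (g := fun y : ℝ => y ^ k) (zero_pow hφ.ne_zero)

lemma integrable_mul (hφ : IsCenteredPowDensity k φ) {g : ℝ → ℝ} (hg : Continuous g) :
    Integrable fun t => g t * φ t ^ k :=
  integrable_mul_of_hasCompactSupport hg hφ.integrable hφ.hasCompactSupport_pow

lemma integrableOn_rpow_mul (hφ : IsCenteredPowDensity k φ) (hp : 0 ≤ p) :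
    IntegrableOn (fun t => t ^ p * φ t ^ k) (Ioi 0) :=
  (hφ.integrable_mul (Real.continuous_rpow_const hp)).integrableOn

lemma isBalanced_sub (hγ : IsCenteredPowDensity k γ) (hφ : IsCenteredPowDensity k φ) :
    IsBalanced fun t => γ t ^ k - φ t ^ k where
  integrable := hγ.integrable.sub hφ.integrable
  hasCompactSupport := by
    simp only [sub_eq_add_neg]
    exact hγ.hasCompactSupport_pow.add hφ.hasCompactSupport_pow.neg
  integral_eq_zero := by
    rw [integral_sub hγ.integrable hφ.integrable, hγ.integral_eq, hφ.integral_eq, sub_self]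
  integral_mul_eq_zero := by
    simp only [mul_sub]
    rw [integral_sub (hγ.integrable_mul continuous_id') (hφ.integrable_mul continuous_id'),
      hγ.mean_eq, hφ.mean_eq, sub_self]

lemma posMoment_sub (hγ : IsCenteredPowDensity k γ) (hφ : IsCenteredPowDensity k φ) (hp : 0 ≤ p) :
    posMoment p (fun t => γ t ^ k - φ t ^ k) =
      posMoment p (fun t => γ t ^ k) - posMoment p fun t => φ t ^ k :=
  _root_.posMoment_sub (hγ.integrableOn_rpow_mul hp) (hφ.integrableOn_rpow_mul hp)

lemma posMoment_pos (hφ : IsCenteredPowDensity k φ) (hp : 0 ≤ p) :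
    0 < posMoment p fun t => φ t ^ k := by
  refine (setIntegral_nonneg measurableSet_Ioi fun t ht => mul_nonneg
    (Real.rpow_nonneg (le_of_lt ht) p) (pow_nonneg (hφ.nonneg t) k)).lt_of_ne' fun h => ?_
  have hright := ae_eq_zero_of_posMoment_eq_zero (fun t _ => pow_nonneg (hφ.nonneg t) k)
    (hφ.integrableOn_rpow_mul hp) h
  have hleft := ae_eq_zero_of_posMoment_eq_zero (p := 1)
    (fun t _ => pow_nonneg (hφ.nonneg (-t)) k) (hφ.comp_neg.integrableOn_rpow_mul zero_le_one) <| by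
      have := integral_mul_eq_posMoment_sub hφ.integrable hφ.hasCompactSupport_pow
      rw [hφ.mean_eq, posMoment_eq_zero_of_ae hright] at this
      linarith
  have hmass := integral_eq_posMoment_add hφ.integrable
  rw [posMoment_eq_zero_of_ae hright, posMoment_eq_zero_of_ae hleft, hφ.integral_eq] at hmass
  norm_num at hmass

lemma exists_pos_le (hφ : IsCenteredPowDensity k φ) (hγ : IsCenteredPowDensity k γ) (hp : 0 ≤ p)
    (h : posMoment p (fun t => γ t ^ k) = posMoment p fun t => φ t ^ k) :
    ∃ x > 0, 0 < φ x ∧ γ x ≤ φ x := by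
  by_contra! hlt
  have hle : ∀ t > 0, φ t ≤ γ t := fun t ht =>
    (hφ.nonneg t).eq_or_lt.elim (fun h₀ => h₀ ▸ hγ.nonneg t) fun h₀ => (hlt t ht h₀).le
  have hD := hγ.isBalanced_sub hφ
  have hzero := ae_eq_zero_of_posMoment_eq_zero
    (fun t ht => sub_nonneg.2 (pow_le_pow_left₀ (hφ.nonneg t) (hle t ht) k))
    (integrable_mul_of_hasCompactSupport (Real.continuous_rpow_const hp) hD.integrable
      hD.hasCompactSupport).integrableOn
    (by rw [hγ.posMoment_sub hφ hp, h, sub_self])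
  refine (hφ.posMoment_pos hp).ne' (posMoment_eq_zero_of_ae ?_ p)
  filter_upwards [hzero, ae_restrict_mem measurableSet_Ioi] with t ht ht₀
  have hpow : γ t ^ k = φ t ^ k := sub_eq_zero.1 ht
  by_contra hne
  have hpos : 0 < φ t := (hφ.nonneg t).lt_of_ne' fun h₀ => hne (by simp [h₀, hφ.ne_zero])
  exact (pow_lt_pow_left₀ (hlt t ht₀ hpos) hpos.le hφ.ne_zero).ne' hpow

lemma alternates_sub (hγ : IsCenteredPowDensity k γ) (hφ : IsCenteredPowDensity k φ) {n : ℕ} {a : ℝ}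
    (h : Alternates (fun t => γ t ^ k - φ t ^ k) n a) : Alternates (fun t => γ t - φ t) n a := by
  refine h.mono_sign (fun x hx => ?_) (fun x hx => ?_)
  · exact sub_pos.2 (lt_of_pow_lt_pow_left₀ k (hγ.nonneg x) (sub_pos.1 hx))
  · exact sub_neg.2 (lt_of_pow_lt_pow_left₀ k (hφ.nonneg x) (sub_neg.1 hx))

lemma alternates_neg_sub (hγ : IsCenteredPowDensity k γ) (hφ : IsCenteredPowDensity k φ) {n : ℕ}
    {a : ℝ} (h : Alternates (-fun t => γ t ^ k - φ t ^ k) n a) :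
    Alternates (fun t => φ t - γ t) n a :=
  hφ.alternates_sub hγ (h.mono_sign (by simp) (by simp))

lemma posMoment_le_of_convexOn (hφ : IsCenteredPowDensity k φ) (hγ : IsCenteredPowDensity k γ)
    (hc : ConcaveOnPos φ) (hl : ConvexOn ℝ (Iic m) γ) (hr : ConvexOn ℝ (Ici m) γ)
    (hp : 1 < p) (hpq : p < q)
    (hpos : posMoment p (fun t => γ t ^ k) = posMoment p fun t => φ t ^ k)
    (hneg : posMoment p (fun t => γ (-t) ^ k) = posMoment p fun t => φ (-t) ^ k) :
    posMoment q (fun t => φ t ^ k) ≤ posMoment q (fun t => γ t ^ k) ∧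
      (posMoment q (fun t => φ t ^ k) = posMoment q (fun t => γ t ^ k) →
        EqOn (stopLoss fun t => γ t ^ k - φ t ^ k) 0 (Ici 0)) := by
  have hp₀ : 0 ≤ p := by linarith
  obtain ⟨x₀, hx₀, hφx₀, hγx₀⟩ := hφ.comp_neg.exists_pos_le hγ.comp_neg hp₀ hneg
  have hmoment := (hγ.isBalanced_sub hφ).posMoment_nonneg hp hpq
    (by rw [hγ.posMoment_sub hφ hp₀, hpos, sub_self])
    (by rw [hγ.comp_neg.posMoment_sub hφ.comp_neg hp₀, hneg, sub_self]) ?_ ?_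
  · rw [hγ.posMoment_sub hφ (by linarith), sub_nonneg, sub_eq_zero] at hmoment
    exact ⟨hmoment.1, fun h => hmoment.2 h.symm⟩
  · intro a h
    obtain ⟨x₁, -, h₁, x₂, h₁₂, h₂, x₃, h₂₃, h₃, x₄, h₃₄, h₄, x₅, h₄₅, h₅, -⟩ :=
      hγ.alternates_neg_sub hφ h
    simp only [Pi.neg_apply, neg_neg, neg_sub, sub_pos] at h₁ h₂ h₃ h₄ h₅
    have hφ₃ : 0 < φ x₃ := (hγ.nonneg _).trans_lt h₃
    rcases le_total x₃ m with hm | hm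
    · exact h₂.not_ge (hc.le_of_convexOn hl (((h₁₂.trans h₂₃).le.trans hm : x₁ ≤ m)) hm h₁₂ h₂₃
        ((hγ.nonneg _).trans_lt h₁) hφ₃ h₁.le h₃.le)
    · exact h₄.not_ge (hc.le_of_convexOn hr hm (hm.trans (h₃₄.trans h₄₅).le : m ≤ x₅) h₃₄ h₄₅
        hφ₃ ((hγ.nonneg _).trans_lt h₅) h₃.le h₅.le)
  · intro h
    obtain ⟨x₁, h₀₁, h₁, x₂, h₁₂, h₂, x₃, h₂₃, h₃, x₄, h₃₄, h₄, -⟩ := hγ.alternates_sub hφ h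
    simp only [Pi.neg_apply, neg_neg, neg_sub, sub_pos] at h₁ h₂ h₃ h₄
    have hφ₂ : 0 < φ x₂ := (hγ.nonneg _).trans_lt h₂
    have h₀ : -x₀ < x₁ := by linarith
    rcases le_total x₂ m with hm | hm
    · exact h₁.not_ge (hc.le_of_convexOn hl ((h₀.trans h₁₂).le.trans hm : -x₀ ≤ m) hm h₀ h₁₂
        hφx₀ hφ₂ hγx₀ h₂.le)
    · exact h₃.not_ge (hc.le_of_convexOn hr hm (hm.trans (h₂₃.trans h₃₄).le : m ≤ x₄) h₂₃ h₃₄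
        hφ₂ ((hγ.nonneg _).trans_lt h₄) h₂.le h₄.le)

lemma integral_Ioi_eq_of_stopLoss_eq_zero (hφ : IsCenteredPowDensity k φ)
    (hγ : IsCenteredPowDensity k γ) (h : stopLoss (fun t => γ t ^ k - φ t ^ k) = 0) (z : ℝ) :
    ∫ t in Ioi z, φ t ^ k = ∫ t in Ioi z, γ t ^ k := by
  have htail := congrFun ((hγ.isBalanced_sub hφ).tailIntegral_eq_zero_of_stopLoss_eq_zero h) z
  rw [tailIntegral, integral_sub hγ.integrable.integrableOn hφ.integrable.integrableOn] at htail
  exact (sub_eq_zero.1 htail).symm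

theorem posMoment_le_and_integral_Ioi_eq (hφ : IsCenteredPowDensity k φ)
    (hγ : IsCenteredPowDensity k γ)
    (hc : ConcaveOnPos φ) (hl : ConvexOn ℝ (Iic m) γ) (hr : ConvexOn ℝ (Ici m) γ)
    (hp : 1 < p) (hpq : p < q)
    (hpos : posMoment p (fun t => γ t ^ k) = posMoment p fun t => φ t ^ k)
    (hneg : posMoment p (fun t => γ (-t) ^ k) = posMoment p fun t => φ (-t) ^ k) :
    posMoment q (fun t => φ t ^ k) ≤ posMoment q (fun t => γ t ^ k) ∧
    posMoment q (fun t => φ (-t) ^ k) ≤ posMoment q (fun t => γ (-t) ^ k) ∧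
      (posMoment q (fun t => φ t ^ k) = posMoment q (fun t => γ t ^ k) →
        posMoment q (fun t => φ (-t) ^ k) = posMoment q (fun t => γ (-t) ^ k) →
        ∀ z, ∫ t in Ioi z, φ t ^ k = ∫ t in Ioi z, γ t ^ k) := by
  have hD := hγ.isBalanced_sub hφ
  have hl' : ConvexOn ℝ (Ici (-m)) fun t => γ (-t) :=
    (hl.comp_linearMap (-LinearMap.id)).subset (fun _ ht => neg_le (α := ℝ).1 ht) (convex_Ici _)
  have hr' : ConvexOn ℝ (Iic (-m)) fun t => γ (-t) :=
    (hr.comp_linearMap (-LinearMap.id)).subset (fun _ ht => le_neg (α := ℝ).1 ht) (convex_Iic _)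
  obtain ⟨hle, hzero⟩ := hφ.posMoment_le_of_convexOn hγ hc hl hr hp hpq hpos hneg
  obtain ⟨hle', hzero'⟩ := hφ.comp_neg.posMoment_le_of_convexOn hγ.comp_neg hc.comp_neg hr' hl'
    hp hpq hneg (by simpa using hpos)
  refine ⟨hle, hle', fun heq heq' => hφ.integral_Ioi_eq_of_stopLoss_eq_zero hγ (funext fun z => ?_)⟩
  rcases le_total 0 z with hz | hz
  · exact hzero heq hz
  · simpa [hD.stopLoss_comp_neg] using hzero' heq' (neg_nonneg.2 hz)

theorem posMoment_le_of_eq_zero (hφ : IsCenteredPowDensity k φ) (hγ : IsCenteredPowDensity k γ)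
    (hc : ConcaveOnPos φ) (hl : ConvexOn ℝ (Iic m) γ) (hr : ∀ t > m, γ t = 0) (hp : 1 < p)
    (hneg : posMoment p (fun t => γ (-t) ^ k) = posMoment p fun t => φ (-t) ^ k) :
    posMoment p (fun t => γ t ^ k) ≤ posMoment p fun t => φ t ^ k := by
  have hp₀ : 0 ≤ p := by linarith
  obtain ⟨x₀, hx₀, hφx₀, hγx₀⟩ := hφ.comp_neg.exists_pos_le hγ.comp_neg hp₀ hneg
  have hm : ∀ {t}, φ t < γ t → t ≤ m := fun ht => not_lt.1 fun hmt =>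
    (hφ.nonneg _).not_gt (hr _ hmt ▸ ht)
  have hmoment := (hγ.isBalanced_sub hφ).posMoment_nonpos hp
    (by rw [hγ.comp_neg.posMoment_sub hφ.comp_neg hp₀, hneg, sub_self]) ?_ ?_
  · rwa [hγ.posMoment_sub hφ hp₀, sub_nonpos] at hmoment
  · intro a h
    obtain ⟨x₁, -, h₁, x₂, h₁₂, h₂, x₃, h₂₃, h₃, x₄, h₃₄, h₄, -⟩ := hγ.alternates_neg_sub hφ h
    simp only [Pi.neg_apply, neg_neg, neg_sub, sub_pos] at h₁ h₂ h₃ h₄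
    have hx₃ : x₃ ≤ m := h₃₄.le.trans (hm h₄)
    exact h₂.not_ge (hc.le_of_convexOn hl ((h₁₂.trans h₂₃).le.trans hx₃ : x₁ ≤ m) hx₃ h₁₂ h₂₃
      ((hγ.nonneg _).trans_lt h₁) ((hγ.nonneg _).trans_lt h₃) h₁.le h₃.le)
  · intro h
    obtain ⟨x₁, h₀₁, h₁, x₂, h₁₂, h₂, x₃, h₂₃, h₃, -⟩ := hγ.alternates_sub hφ h
    simp only [Pi.neg_apply, neg_sub, sub_pos] at h₁ h₂ h₃
    have hx₂ : x₂ ≤ m := h₂₃.le.trans (hm h₃)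
    have h₀ : -x₀ < x₁ := by linarith
    exact h₁.not_ge (hc.le_of_convexOn hl ((h₀.trans h₁₂).le.trans hx₂ : -x₀ ≤ m) hx₂ h₀ h₁₂
      hφx₀ ((hγ.nonneg _).trans_lt h₂) hγx₀ h₂.le)

end IsCenteredPowDensity

end PowDensity

section Slices

open Set

open Measure in
lemma map_cond_continuousLinearEquiv {E F : Type*} [NormedAddCommGroup E] [NormedSpace ℝ E]
    [MeasurableSpace E] [BorelSpace E] [NormedAddCommGroup F] [NormedSpace ℝ F]
    [FiniteDimensional ℝ F] [MeasurableSpace F] [BorelSpace F] (μ : Measure E)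
    [μ.IsAddHaarMeasure] (ν : Measure F) [ν.IsAddHaarMeasure] (e : E ≃L[ℝ] F) (K : Set E) :
    (cond μ K).map e = cond ν (e '' K) := by
  have hemb : MeasurableEmbedding e := e.toHomeomorph.measurableEmbedding
  obtain ⟨c, hc, hμν⟩ : ∃ c : NNReal, c ≠ 0 ∧ μ.map e = c • ν :=
    ⟨_, (addHaarScalarFactor_pos_of_isAddHaarMeasure (μ.map e) ν).ne',
      isAddLeftInvariant_eq_smul _ _⟩
  have hc₀ : (c : ENNReal) ≠ 0 := by exact_mod_cast hc
  have hK : μ K = c * ν (e '' K) := by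
    rw [← smul_eq_mul, ← ENNReal.smul_def, ← Measure.smul_apply, ← hμν, hemb.map_apply,
      preimage_image_eq K e.injective]
  have hrestrict : (μ.restrict K).map e = (c : ENNReal) • ν.restrict (e '' K) := by
    rw [← Measure.restrict_smul, ← ENNReal.smul_def, ← hμν, hemb.restrict_map,
      preimage_image_eq _ e.injective]
  rw [ProbabilityTheory.cond, ProbabilityTheory.cond, Measure.map_smul, hrestrict, hK, smul_smul,
    ENNReal.mul_inv (.inl hc₀) (.inl ENNReal.coe_ne_top), mul_right_comm,
    ENNReal.inv_mul_cancel hc₀ ENNReal.coe_ne_top, one_mul]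

/-- The `k`-th root of the density of the first coordinate of a uniform point of `K`. -/
noncomputable def sliceRoot {k : ℕ} (K : Set (ℝ × (Fin k → ℝ))) (t : ℝ) : ℝ :=
  ((volume K).toReal⁻¹ * (volume (Prod.mk t ⁻¹' K)).toReal) ^ (k : ℝ)⁻¹

variable {k : ℕ} {K : Set (ℝ × (Fin k → ℝ))}

lemma sliceRoot_nonneg (t : ℝ) : 0 ≤ sliceRoot K t := by unfold sliceRoot; positivity

lemma sliceRoot_pow (hk : k ≠ 0) (t : ℝ) :
    sliceRoot K t ^ k = (volume K).toReal⁻¹ * (volume (Prod.mk t ⁻¹' K)).toReal :=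
  Real.rpow_inv_natCast_pow (by positivity) hk

lemma sliceRoot_eq_zero (hk : k ≠ 0) {t : ℝ} (h : volume (Prod.mk t ⁻¹' K) = 0) :
    sliceRoot K t = 0 := by
  simp [sliceRoot, h, hk]

lemma sliceRoot_eq_zero_of_forall_fst_ne (hk : k ≠ 0) {t : ℝ} (h : ∀ x ∈ K, x.1 ≠ t) :
    sliceRoot K t = 0 := by
  have hempty : Prod.mk t ⁻¹' K = ∅ := eq_empty_of_forall_notMem fun y hy => h _ hy rfl
  exact sliceRoot_eq_zero hk (by rw [hempty, measure_empty])

lemma sliceRoot_homothety (hk : k ≠ 0) {c : ℝ × (Fin k → ℝ)} {m r : ℝ} (hr : 0 < r)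
    (h : ∀ x : ℝ × (Fin k → ℝ), x.1 = m → (AffineMap.homothety c r x ∈ K ↔ x ∈ K)) :
    sliceRoot K (AffineMap.homothety c.1 r m) = r * sliceRoot K m := by
  have hslice : Prod.mk (AffineMap.homothety c.1 r m) ⁻¹' K =
      AffineMap.homothety c.2 r '' (Prod.mk m ⁻¹' K) := by
    ext z
    constructor
    · have hz' : AffineMap.homothety c.2 r (AffineMap.homothety c.2 r⁻¹ z) = z := by
        simp [AffineMap.homothety_apply, hr.ne']
      exact fun hz => ⟨_, (h (m, _) rfl).1 (by rwa [← hz'] at hz), hz'⟩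
    · rintro ⟨y, hy, rfl⟩
      exact (h (m, y) rfl).2 hy
  rw [sliceRoot, hslice, Measure.addHaar_image_homothety, Module.finrank_fin_fun, abs_of_nonneg
    (by positivity), ENNReal.toReal_mul, ENNReal.toReal_ofReal (by positivity), mul_left_comm,
    Real.mul_rpow (by positivity) (by positivity), Real.pow_rpow_inv_natCast hr.le hk, sliceRoot]

variable (hK : IsCompact K)
include hK

lemma isCompact_slice (t : ℝ) : IsCompact (Prod.mk t ⁻¹' K) :=
  Topology.IsClosedEmbedding.isCompact_preimage
    (.of_continuous_injective_isClosedMap (by fun_prop) (Prod.mk_right_injective t) fun s hs => by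
      simpa only [singleton_prod] using isClosed_singleton.prod hs) hK

lemma measurable_sliceRoot : Measurable (sliceRoot K) :=
  ((measurable_measure_prodMk_left hK.measurableSet).ennreal_toReal.const_mul _).pow_const _

lemma hasCompactSupport_sliceRoot (hk : k ≠ 0) : HasCompactSupport (sliceRoot K) :=
  .intro (hK.image continuous_fst) fun _ ht => sliceRoot_eq_zero_of_forall_fst_ne hk
    fun x hx hxt => ht ⟨x, hx, hxt⟩

lemma concaveOnPos_sliceRoot (hk : k ≠ 0) (hconv : Convex ℝ K) : ConcaveOnPos (sliceRoot K) := by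
  intro x z hx hz l hl₀ hl₁
  have hne : ∀ {t : ℝ}, 0 < sliceRoot K t → volume (Prod.mk t ⁻¹' K) ≠ 0 := fun ht h =>
    ht.ne' (sliceRoot_eq_zero hk h)
  have hfin : ∀ t, volume (Prod.mk t ⁻¹' K) ^ (k : ℝ)⁻¹ ≠ ⊤ := fun t =>
    ENNReal.rpow_ne_top_of_nonneg (by positivity) (isCompact_slice hK t).measure_ne_top
  have hroot : ∀ t, sliceRoot K t =
      (volume K).toReal⁻¹ ^ (k : ℝ)⁻¹ * (volume (Prod.mk t ⁻¹' K) ^ (k : ℝ)⁻¹).toReal := fun t => by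
    rw [sliceRoot, Real.mul_rpow (by positivity) (by positivity), ENNReal.toReal_rpow]
  have hBM := ENNReal.toReal_mono (hfin _) (brunn_minkowski hk (isCompact_slice hK x).measurableSet
    (isCompact_slice hK z).measurableSet (isCompact_slice hK ((1 - l) * x + l * z)).measurableSet
    (hne hx) (hne hz) hl₀ hl₁ fun a ha b hb =>
      by simpa using hconv ha hb (sub_nonneg.2 hl₁.le) hl₀.le (sub_add_cancel 1 l))
  rw [ENNReal.toReal_add (ENNReal.mul_ne_top ENNReal.ofReal_ne_top (hfin x))
    (ENNReal.mul_ne_top ENNReal.ofReal_ne_top (hfin z)), ENNReal.toReal_mul, ENNReal.toReal_mul,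
    ENNReal.toReal_ofReal (sub_nonneg.2 hl₁.le), ENNReal.toReal_ofReal hl₀.le] at hBM
  rw [hroot, hroot, hroot, mul_left_comm, mul_left_comm l, ← mul_add]
  gcongr

lemma map_fst_cond (hk : k ≠ 0) (h₀ : volume K ≠ 0) :
    (cond volume K).map Prod.fst =
      volume.withDensity fun t => ENNReal.ofReal (sliceRoot K t ^ k) := by
  have hfin : volume K ≠ ⊤ := hK.measure_ne_top
  ext B hB
  have hKB := hK.measurableSet.inter (measurable_fst hB)
  rw [Measure.map_apply measurable_fst hB, cond_apply hK.measurableSet, withDensity_apply _ hB,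
    Measure.volume_eq_prod, Measure.prod_apply hKB,
    ← lintegral_const_mul _ (measurable_measure_prodMk_left hKB), ← lintegral_indicator hB]
  refine lintegral_congr fun t => ?_
  by_cases ht : t ∈ B
  · have hslice : Prod.mk t ⁻¹' (K ∩ Prod.fst ⁻¹' B) = Prod.mk t ⁻¹' K := by ext y; simp [ht]
    rw [hslice, indicator_of_mem ht, sliceRoot_pow hk, ENNReal.ofReal_mul (by positivity),
      ENNReal.ofReal_inv_of_pos (ENNReal.toReal_pos h₀ hfin), ENNReal.ofReal_toReal hfin,
      ENNReal.ofReal_toReal (isCompact_slice hK t).measure_ne_top, Measure.volume_eq_prod]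
  · have hslice : Prod.mk t ⁻¹' (K ∩ Prod.fst ⁻¹' B) = ∅ := by ext y; simp [ht]
    rw [hslice, indicator_of_notMem ht, measure_empty, mul_zero]

end Slices

section Marginals

open Set

/-- The moment `E (X · θ)₊ ^ p` for `X` uniform on `K`. -/
noncomputable def posPartMoment {n : ℕ} (p : ℝ) (K : Set (EuclideanSpace ℝ (Fin n)))
    (θ : EuclideanSpace ℝ (Fin n)) : ℝ :=
  ∫ x, max (inner ℝ x θ) 0 ^ p ∂(uniformLaw K)

/-- `μ` is a law on the line with mean zero and density `φ ^ k`, where `φ` has compact support. -/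
structure HasCenteredPowDensity (μ : Measure ℝ) (k : ℕ) (φ : ℝ → ℝ) : Prop
    extends IsCenteredPowDensity k φ where
  eq_withDensity : μ = volume.withDensity fun t => ENNReal.ofReal (φ t ^ k)

lemma integral_withDensity_ofReal {f h : ℝ → ℝ} (hf : AEMeasurable f) (hf₀ : ∀ t, 0 ≤ f t) :
    ∫ t, h t ∂(volume.withDensity fun t => ENNReal.ofReal (f t)) = ∫ t, h t * f t := by
  rw [integral_withDensity_eq_integral_toReal_smul₀ hf.ennreal_ofReal
    (.of_forall fun _ => ENNReal.ofReal_lt_top)]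
  simp only [ENNReal.toReal_ofReal (hf₀ _), smul_eq_mul, mul_comm]

lemma integral_max_rpow_mul {p : ℝ} (hp : p ≠ 0) (f : ℝ → ℝ) :
    ∫ t, max t 0 ^ p * f t = posMoment p f := by
  rw [posMoment, ← integral_indicator measurableSet_Ioi]
  congr 1 with t
  rcases lt_or_ge 0 t with ht | ht
  · rw [indicator_of_mem (mem_Ioi.2 ht), max_eq_left ht.le]
  · rw [indicator_of_notMem (notMem_Ioi.2 ht), max_eq_right ht, Real.zero_rpow hp, zero_mul]

section

variable {n : ℕ} {K : Set (EuclideanSpace ℝ (Fin n))} {θ : EuclideanSpace ℝ (Fin n)} {p : ℝ}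

lemma integral_marginalLaw {h : ℝ → ℝ} (hh : Continuous h) :
    ∫ t, h t ∂(marginalLaw K θ) = ∫ x, h (inner ℝ x θ) ∂(uniformLaw K) := by
  rw [marginalLaw, integral_map (by fun_prop) hh.aestronglyMeasurable]

lemma marginalLaw_smul (c : ℝ) : marginalLaw K (c • θ) = (marginalLaw K θ).map fun t => c * t := by
  rw [marginalLaw, marginalLaw, Measure.map_map (by fun_prop) (by fun_prop)]
  congr 1 with x
  exact inner_smul_right x θ c

lemma marginalLaw_neg : marginalLaw K (-θ) = (marginalLaw K θ).map fun t => -t := by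
  simpa using marginalLaw_smul (K := K) (θ := θ) (-1)

lemma posPartMoment_eq_integral_marginalLaw (hp : 0 ≤ p) :
    posPartMoment p K θ = ∫ t, max t 0 ^ p ∂(marginalLaw K θ) :=
  (integral_marginalLaw ((continuous_id.max continuous_const).rpow_const fun _ => .inr hp)).symm

lemma posPartMoment_smul {c : ℝ} (hc : 0 ≤ c) :
    posPartMoment p K (c • θ) = c ^ p * posPartMoment p K θ := by
  rw [posPartMoment, posPartMoment, ← integral_const_mul]
  congr 1 with x
  rw [inner_smul_right, ← Real.mul_rpow hc (le_max_right _ _), mul_max_of_nonneg _ _ hc, mul_zero]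

namespace HasCenteredPowDensity

variable {μ ν : Measure ℝ} {k : ℕ} {φ γ : ℝ → ℝ}

lemma posPartMoment_eq (hφ : HasCenteredPowDensity (marginalLaw K θ) k φ) (hp : 0 < p) :
    posPartMoment p K θ = posMoment p fun t => φ t ^ k := by
  rw [posPartMoment_eq_integral_marginalLaw hp.le, hφ.eq_withDensity, integral_withDensity_ofReal
    hφ.integrable.aemeasurable fun t => pow_nonneg (hφ.nonneg t) k, integral_max_rpow_mul hp.ne']

lemma map_neg (hφ : HasCenteredPowDensity μ k φ) :
    HasCenteredPowDensity (μ.map fun t => -t) k fun t => φ (-t) where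
  toIsCenteredPowDensity := hφ.comp_neg
  eq_withDensity := by
    ext s hs
    rw [Measure.map_apply measurable_neg hs, hφ.eq_withDensity,
      withDensity_apply _ (measurable_neg hs), withDensity_apply _ hs]
    simpa using (Measure.measurePreserving_neg volume).setLIntegral_comp_preimage_emb
      (Homeomorph.neg ℝ).measurableEmbedding (fun t => ENNReal.ofReal (φ (-t) ^ k)) s

lemma posPartMoment_neg_eq (hφ : HasCenteredPowDensity (marginalLaw K θ) k φ) (hp : 0 < p) :
    posPartMoment p K (-θ) = posMoment p fun t => φ (-t) ^ k :=
  (marginalLaw_neg (K := K) ▸ hφ.map_neg).posPartMoment_eq hp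

lemma apply_Iic (hφ : HasCenteredPowDensity μ k φ) (a : ℝ) :
    μ (Iic a) = ENNReal.ofReal (1 - ∫ t in Ioi a, φ t ^ k) := by
  have hcompl := integral_add_compl (measurableSet_Ioi (a := a)) hφ.integrable
  rw [compl_Ioi, hφ.integral_eq] at hcompl
  rw [hφ.eq_withDensity, withDensity_apply _ measurableSet_Iic,
    ← ofReal_integral_eq_lintegral_ofReal hφ.integrable.integrableOn
      (.of_forall fun t => pow_nonneg (hφ.nonneg t) k), ← hcompl, add_sub_cancel_left]

lemma measure_eq_of_integral_Ioi_eq (hφ : HasCenteredPowDensity μ k φ)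
    (hγ : HasCenteredPowDensity ν k γ)
    (h : ∀ z, ∫ t in Ioi z, φ t ^ k = ∫ t in Ioi z, γ t ^ k) : μ = ν := by
  have : IsFiniteMeasure μ :=
    hφ.eq_withDensity ▸ isFiniteMeasure_withDensity_ofReal hφ.integrable.2
  exact Measure.ext_of_Iic _ _ fun a => by rw [hφ.apply_Iic, hγ.apply_Iic, h]

end HasCenteredPowDensity

end

namespace IsConvexBody

variable {n : ℕ} {K : Set (EuclideanSpace ℝ (Fin n))}

lemma volume_ne_zero (hK : IsConvexBody K) : volume K ≠ 0 :=
  (Measure.measure_pos_of_nonempty_interior _ hK.nonempty_interior).ne'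

lemma isProbabilityMeasure (hK : IsConvexBody K) : IsProbabilityMeasure (uniformLaw K) :=
  cond_isProbabilityMeasure_of_finite hK.volume_ne_zero hK.isCompact.measure_ne_top

lemma integrable_uniformLaw (hK : IsConvexBody K) {F : Type*} [NormedAddCommGroup F]
    {h : EuclideanSpace ℝ (Fin n) → F} (hh : Continuous h) : Integrable h (uniformLaw K) :=
  (hh.continuousOn.integrableOn_compact hK.isCompact).smul_measure (by simp [hK.volume_ne_zero])

lemma integral_marginalLaw_eq_zero (hK : IsConvexBody K) (hK₀ : IsCentered K)
    (θ : EuclideanSpace ℝ (Fin n)) : ∫ t, t ∂(marginalLaw K θ) = 0 := by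
  simp_rw [integral_marginalLaw continuous_id', real_inner_comm θ]
  rw [integral_inner (hK.integrable_uniformLaw continuous_id') θ, hK₀, inner_zero_right]

lemma continuous_integral_inner (hK : IsConvexBody K) {h : ℝ → ℝ} (hh : Continuous h) :
    Continuous fun θ : EuclideanSpace ℝ (Fin n) => ∫ x, h (inner ℝ x θ) ∂(uniformLaw K) := by
  have hcont : Continuous fun θ : EuclideanSpace ℝ (Fin n) => ∫ x in K, h (inner ℝ x θ) :=
    continuous_parametric_integral_of_continuous
      (f := fun (θ x : EuclideanSpace ℝ (Fin n)) => h (inner ℝ x θ))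
      (hh.comp (continuous_snd.inner continuous_fst)) hK.isCompact
  simp only [uniformLaw, ProbabilityTheory.cond, integral_smul_measure]
  exact hcont.const_smul (volume K)⁻¹.toReal

lemma continuous_posPartMoment (hK : IsConvexBody K) {p : ℝ} (hp : 0 ≤ p) :
    Continuous (posPartMoment p K) :=
  hK.continuous_integral_inner ((continuous_id.max continuous_const).rpow_const fun _ => .inr hp)

end IsConvexBody

lemma exists_continuousLinearEquiv_fst_eq_inner {k : ℕ} {θ : EuclideanSpace ℝ (Fin (k + 1))}
    (hθ : θ ≠ 0) : ∃ e : EuclideanSpace ℝ (Fin (k + 1)) ≃L[ℝ] ℝ × (Fin k → ℝ),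
      ∀ x, (e x).1 = inner ℝ x θ := by
  obtain ⟨i, hi⟩ : ∃ i, θ i ≠ 0 := by
    by_contra! h
    exact hθ (by ext i; simpa using h i)
  let A : EuclideanSpace ℝ (Fin (k + 1)) →ₗ[ℝ] ℝ × (Fin k → ℝ) :=
    { toFun x := (inner ℝ x θ, fun j => x (i.succAbove j))
      map_add' x y := by ext <;> simp [inner_add_left]
      map_smul' c x := by ext <;> simp [inner_smul_left] }
  have hA : Function.Injective A := by
    rw [injective_iff_map_eq_zero]
    intro x hx
    have hinner : inner ℝ x θ = 0 := congrArg Prod.fst hx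
    have hcoord : ∀ j, x (i.succAbove j) = 0 := congrFun (congrArg Prod.snd hx)
    rw [PiLp.inner_apply, Fin.sum_univ_succAbove _ i] at hinner
    have hxi : x i = 0 := by simpa [hcoord, hi] using hinner
    ext l
    rcases i.eq_self_or_eq_succAbove l with rfl | ⟨j, rfl⟩
    exacts [hxi, hcoord j]
  exact ⟨(A.linearEquivOfInjective hA (by simp [add_comm])).toContinuousLinearEquiv, fun _ => rfl⟩

section

variable {k : ℕ} {K : Set (EuclideanSpace ℝ (Fin (k + 1)))} {θ : EuclideanSpace ℝ (Fin (k + 1))}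
  {e : EuclideanSpace ℝ (Fin (k + 1)) ≃L[ℝ] ℝ × (Fin k → ℝ)}

lemma marginalLaw_eq_map_fst (he : ∀ x, (e x).1 = inner ℝ x θ) :
    marginalLaw K θ = (cond volume (e '' K)).map Prod.fst := by
  have : (volume : Measure (ℝ × (Fin k → ℝ))).IsAddHaarMeasure := by
    rw [Measure.volume_eq_prod]; infer_instance
  rw [← map_cond_continuousLinearEquiv volume volume e K,
    Measure.map_map measurable_fst e.continuous.measurable, marginalLaw, uniformLaw]
  congr 1 with x
  exact (he x).symm

namespace IsConvexBody

lemma volume_image_ne_zero (hK : IsConvexBody K) : volume (e '' K) ≠ 0 := by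
  have : (volume : Measure (ℝ × (Fin k → ℝ))).IsAddHaarMeasure := by
    rw [Measure.volume_eq_prod]; infer_instance
  have hinterior := hK.nonempty_interior.image e.toHomeomorph
  rw [e.toHomeomorph.image_interior] at hinterior
  exact (Measure.measure_pos_of_nonempty_interior _ hinterior).ne'

lemma hasCenteredPowDensity_sliceRoot (hK : IsConvexBody K) (hK₀ : IsCentered K) (hk : k ≠ 0)
    (he : ∀ x, (e x).1 = inner ℝ x θ) :
    HasCenteredPowDensity (marginalLaw K θ) k (sliceRoot (e '' K)) := by
  have hc := hK.isCompact.image e.continuous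
  have hprob := hK.isProbabilityMeasure
  have hnn : ∀ t, 0 ≤ sliceRoot (e '' K) t ^ k := fun t => pow_nonneg (sliceRoot_nonneg t) k
  have hm : Measurable fun t => sliceRoot (e '' K) t ^ k := (measurable_sliceRoot hc).pow_const k
  have hlaw : marginalLaw K θ =
      volume.withDensity fun t => ENNReal.ofReal (sliceRoot (e '' K) t ^ k) := by
    rw [marginalLaw_eq_map_fst he, map_fst_cond hc hk hK.volume_image_ne_zero]
  have hmass : ∫⁻ t, ENNReal.ofReal (sliceRoot (e '' K) t ^ k) = 1 := by
    have huniv : marginalLaw K θ univ = 1 := by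
      rw [marginalLaw, Measure.map_apply (by fun_prop) .univ, preimage_univ, measure_univ]
    rwa [hlaw, withDensity_apply _ .univ, Measure.restrict_univ] at huniv
  exact
    { ne_zero := hk
      nonneg := sliceRoot_nonneg
      hasCompactSupport := hasCompactSupport_sliceRoot hc hk
      integrable := ⟨hm.aestronglyMeasurable, by
        simp [hasFiniteIntegral_iff_ofReal (.of_forall hnn), hmass]⟩
      integral_eq := by
        rw [integral_eq_lintegral_of_nonneg_ae (.of_forall hnn) hm.aestronglyMeasurable, hmass,
          ENNReal.toReal_one]
      mean_eq := by
        rw [← integral_withDensity_ofReal hm.aemeasurable hnn, ← hlaw,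
          hK.integral_marginalLaw_eq_zero hK₀]
      eq_withDensity := hlaw }

lemma exists_hasCenteredPowDensity_concaveOnPos (hK : IsConvexBody K) (hK₀ : IsCentered K)
    (hk : k ≠ 0) (hθ : θ ≠ 0) :
    ∃ φ, HasCenteredPowDensity (marginalLaw K θ) k φ ∧ ConcaveOnPos φ := by
  obtain ⟨e, he⟩ := exists_continuousLinearEquiv_fst_eq_inner hθ
  exact ⟨_, hK.hasCenteredPowDensity_sliceRoot hK₀ hk he, concaveOnPos_sliceRoot
    (hK.isCompact.image e.continuous) hk (hK.convex.linear_image e.toLinearEquiv.toLinearMap)⟩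

end IsConvexBody

end

end Marginals

section Simplex

open Set AffineMap

section Barycentric

variable {n : ℕ} (T : Affine.Simplex ℝ (EuclideanSpace ℝ (Fin n)) n)

/-- The vertices of a full-dimensional simplex as an affine basis; its coordinates are the
barycentric coordinates of the simplex. -/
noncomputable def simplexBasis : AffineBasis (Fin (n + 1)) ℝ (EuclideanSpace ℝ (Fin n)) :=
  ⟨T.points, T.independent,
    T.independent.affineSpan_eq_top_iff_card_eq_finrank_add_one.2 (by simp)⟩

lemma mem_solidSimplex_iff {x : EuclideanSpace ℝ (Fin n)} :
    x ∈ solidSimplex T ↔ ∀ l, 0 ≤ (simplexBasis T).coord l x :=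
  Set.ext_iff.1 (simplexBasis T).convexHull_eq_nonneg_coord x

lemma isConvexBody_solidSimplex : IsConvexBody (solidSimplex T) where
  convex := convex_convexHull ℝ _
  isCompact := (finite_range _).isCompact_convexHull ℝ
  nonempty_interior := interior_convexHull_nonempty_iff_affineSpan_eq_top.2 (simplexBasis T).tot

end Barycentric

/-- The functional `⟪·, w⟫` takes the common value `m` on all vertices of `T` other than the `i`-th
and the `j`-th, a value at most `m` on the `i`-th, and a value at least `m` on the `j`-th. The
marginal of the simplex along such a `w` has a tent-shaped density root with its peak at `m`. -/
structure IsTentDirection {n : ℕ} (T : Affine.Simplex ℝ (EuclideanSpace ℝ (Fin n)) n)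
    (i j : Fin (n + 1)) (w : EuclideanSpace ℝ (Fin n)) (m : ℝ) : Prop where
  ne : i ≠ j
  eq : ∀ l, l ≠ i → l ≠ j → inner ℝ (T.points l) w = m
  le : inner ℝ (T.points i) w ≤ m
  ge : m ≤ inner ℝ (T.points j) w

namespace IsTentDirection

section

variable {n : ℕ} {T : Affine.Simplex ℝ (EuclideanSpace ℝ (Fin n)) n} {i j : Fin (n + 1)}
  {w x : EuclideanSpace ℝ (Fin n)} {m r : ℝ}

lemma neg (h : IsTentDirection T i j w m) : IsTentDirection T j i (-w) (-m) where
  ne := h.ne.symm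
  eq l hj hi := by rw [inner_neg_right, h.eq l hi hj]
  le := by simpa using h.ge
  ge := by simpa using h.le

lemma smul (h : IsTentDirection T i j w m) {c : ℝ} (hc : 0 ≤ c) :
    IsTentDirection T i j (c • w) (c * m) where
  ne := h.ne
  eq l hi hj := by rw [inner_smul_right, h.eq l hi hj]
  le := by rw [inner_smul_right]; exact mul_le_mul_of_nonneg_left h.le hc
  ge := by rw [inner_smul_right]; exact mul_le_mul_of_nonneg_left h.ge hc

lemma inner_eq (h : IsTentDirection T i j w m) (x : EuclideanSpace ℝ (Fin n)) :
    inner ℝ x w = m + (simplexBasis T).coord i x * (inner ℝ (T.points i) w - m) +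
      (simplexBasis T).coord j x * (inner ℝ (T.points j) w - m) := by
  have hsum : inner ℝ x w - m =
      ∑ l, (simplexBasis T).coord l x * (inner ℝ (T.points l) w - m) := by
    simp_rw [mul_sub, Finset.sum_sub_distrib, ← Finset.sum_mul,
      (simplexBasis T).sum_coord_apply_eq_one, one_mul, ← real_inner_smul_left, ← sum_inner]
    congr 2
    exact ((simplexBasis T).linear_combination_coord_eq_self x).symm
  rw [Fintype.sum_eq_add i j h.ne fun l hl => by rw [h.eq l hl.1 hl.2, sub_self, mul_zero]] at hsum
  linarith

lemma le_inner (h : IsTentDirection T i j w m) (hx : x ∈ solidSimplex T) :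
    inner ℝ (T.points i) w ≤ inner ℝ x w := by
  have hvertex : range T.points ⊆ {y | inner ℝ (T.points i) w ≤ inner ℝ y w} := by
    rintro _ ⟨l, rfl⟩
    rw [mem_ofPred_eq]
    rcases eq_or_ne l i with rfl | hi
    · rfl
    rcases eq_or_ne l j with rfl | hj
    · exact h.le.trans h.ge
    · exact h.le.trans_eq (h.eq l hi hj).symm
  refine convexHull_min hvertex ?_ hx
  simp_rw [real_inner_comm w]
  exact convex_halfSpace_ge (innerₛₗ ℝ w).isLinear _

lemma inner_le (h : IsTentDirection T i j w m) (hx : x ∈ solidSimplex T) :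
    inner ℝ x w ≤ inner ℝ (T.points j) w := by
  simpa using h.neg.le_inner hx

lemma homothety_mem_iff (h : IsTentDirection T i j w m) (hi : inner ℝ (T.points i) w < m)
    (hr : 0 < r) (hr₁ : r ≤ 1) (hx : inner ℝ x w = m) :
    homothety (T.points i) r x ∈ solidSimplex T ↔ x ∈ solidSimplex T := by
  have hself : (simplexBasis T).coord i (T.points i) = 1 := (simplexBasis T).coord_apply_eq i
  have hcoord : ∀ l ≠ i, (simplexBasis T).coord l (homothety (T.points i) r x) =
      r * (simplexBasis T).coord l x := fun l hl => by
    have hzero : (simplexBasis T).coord l (T.points i) = 0 := (simplexBasis T).coord_apply_ne hl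
    rw [homothety_eq_lineMap, apply_lineMap, hzero, lineMap_apply_ring, mul_zero, zero_add]
  have hcoord_self : (simplexBasis T).coord i (homothety (T.points i) r x) =
      1 - r + r * (simplexBasis T).coord i x := by
    rw [homothety_eq_lineMap, apply_lineMap, hself, lineMap_apply_ring, mul_one]
  -- On the hyperplane the `j`-th coordinate determines the `i`-th and forces its sign.
  have hbalance : (simplexBasis T).coord i x * (m - inner ℝ (T.points i) w) =
      (simplexBasis T).coord j x * (inner ℝ (T.points j) w - m) := by
    linear_combination h.inner_eq x - hx
  simp only [mem_solidSimplex_iff]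
  constructor <;> intro hmem l <;> rcases eq_or_ne l i with rfl | hl
  · have hj : 0 ≤ (simplexBasis T).coord j x :=
      nonneg_of_mul_nonneg_right (hcoord j h.ne.symm ▸ hmem j) hr
    exact nonneg_of_mul_nonneg_left (hbalance ▸ mul_nonneg hj (sub_nonneg.2 h.ge))
      (sub_pos.2 hi)
  · exact nonneg_of_mul_nonneg_right (hcoord l hl ▸ hmem l) hr
  · rw [hcoord_self]
    exact add_nonneg (sub_nonneg.2 hr₁) (mul_nonneg hr.le (hmem l))
  · rw [hcoord l hl]
    exact mul_nonneg hr.le (hmem l)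

lemma eq_of_inner_eq (h : IsTentDirection T i j w m) (hi : inner ℝ (T.points i) w < m)
    (hx : x ∈ solidSimplex T) (hxi : inner ℝ x w = inner ℝ (T.points i) w) :
    x = T.points i := by
  have hnonneg := (mem_solidSimplex_iff T).1 hx
  have hsum := (simplexBasis T).sum_coord_apply_eq_one x
  have hone : 1 ≤ (simplexBasis T).coord i x := by
    have := mul_nonneg (hnonneg j) (sub_nonneg.2 h.ge)
    have := h.inner_eq x
    nlinarith
  rw [Fintype.sum_eq_add_sum_compl i] at hsum
  have hrest : ∑ l ∈ {i}ᶜ, (simplexBasis T).coord l x = 0 :=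
    le_antisymm (by linarith) (Finset.sum_nonneg fun l _ => hnonneg l)
  have hzero : ∀ l ≠ i, (simplexBasis T).coord l x = 0 := fun l hl =>
    (Finset.sum_eq_zero_iff_of_nonneg fun l _ => hnonneg l).1 hrest l (by simpa using hl)
  refine (simplexBasis T).ext_elem fun l => ?_
  change _ = (simplexBasis T).coord l (simplexBasis T i)
  rcases eq_or_ne l i with rfl | hl
  · rw [(simplexBasis T).coord_apply_eq]
    linarith
  · rw [(simplexBasis T).coord_apply_ne hl, hzero l hl]

end

end IsTentDirection

lemma convexOn_Iic_of_affine_of_eq_zero {γ : ℝ → ℝ} {a m : ℝ} (ham : a ≤ m) (hγ : ∀ t, 0 ≤ γ t)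
    (hout : ∀ t < a, γ t = 0)
    (hin : a < m → ∀ r, 0 ≤ r → r ≤ 1 → γ (homothety a r m) = r * γ m) :
    ConvexOn ℝ (Iic m) γ := by
  rcases ham.lt_or_eq with hlt | rfl
  · have hpos : 0 < m - a := sub_pos.2 hlt
    refine ConvexOn.congr (f := fun t => max ((t - a) / (m - a) * γ m) 0) ?_ fun t ht => ?_
    · refine ConvexOn.sup ⟨convex_Iic m, fun x _ y _ c d _ _ hcd => le_of_eq ?_⟩
        (convexOn_const 0 (convex_Iic m))
      simp only [smul_eq_mul]
      linear_combination a / (m - a) * γ m * hcd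
    · rcases lt_or_ge t a with hta | hta
      · rw [hout t hta]
        exact max_eq_right (mul_nonpos_of_nonpos_of_nonneg
          (div_nonpos_of_nonpos_of_nonneg (sub_nonpos.2 hta.le) hpos.le) (hγ m))
      · have hr : 0 ≤ (t - a) / (m - a) := div_nonneg (sub_nonneg.2 hta) hpos.le
        have hline : homothety a ((t - a) / (m - a)) m = t := by
          simp [homothety_apply, hpos.ne']
        rw [← hline, hin hlt _ hr ((div_le_one hpos).2 (sub_le_sub_right ht a)), hline]
        exact max_eq_left (mul_nonneg hr (hγ m))
  · refine convexOn_iff_forall_pos.2 ⟨convex_Iic a, fun x hx y hy c d hc hd hcd => ?_⟩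
    have hle : c • x + d • y ≤ a := convex_Iic a hx hy hc.le hd.le hcd
    rcases hle.lt_or_eq with hlt | heq
    · rw [hout _ hlt]
      exact add_nonneg (mul_nonneg hc.le (hγ x)) (mul_nonneg hd.le (hγ y))
    · simp only [smul_eq_mul, mem_Iic] at heq hx hy ⊢
      have hgap : c * (a - x) + d * (a - y) = 0 := by linear_combination a * hcd - heq
      have hxa : x = a := hx.antisymm (by nlinarith [mul_nonneg hd.le (sub_nonneg.2 hy)])
      have hya : y = a := hy.antisymm (by nlinarith [mul_nonneg hc.le (sub_nonneg.2 hx)])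
      rw [heq, hxa, hya, ← add_mul, hcd, one_mul]

section

variable {k : ℕ} {K : Set (EuclideanSpace ℝ (Fin (k + 1)))}
  {T : Affine.Simplex ℝ (EuclideanSpace ℝ (Fin (k + 1))) (k + 1)}
  {e : EuclideanSpace ℝ (Fin (k + 1)) ≃L[ℝ] ℝ × (Fin k → ℝ)} {i j : Fin (k + 1 + 1)}
  {v w : EuclideanSpace ℝ (Fin (k + 1))} {m r : ℝ}

lemma sliceRoot_image_homothety (hk : k ≠ 0) (he : ∀ x, (e x).1 = inner ℝ x w)
    (hv : ∀ x ∈ K, inner ℝ x w = inner ℝ v w → x = v) (hr : 0 ≤ r)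
    (h : 0 < r → ∀ x, inner ℝ x w = m → (homothety v r x ∈ K ↔ x ∈ K)) :
    sliceRoot (e '' K) (homothety (inner ℝ v w) r m) = r * sliceRoot (e '' K) m := by
  rcases hr.lt_or_eq with hr | rfl
  · rw [← he v]
    refine sliceRoot_homothety hk hr fun y hy => ?_
    obtain ⟨x, rfl⟩ := e.surjective y
    have hmap : homothety (e v) r (e x) = e (homothety v r x) := by
      simp [homothety_apply]
    rw [hmap, e.injective.mem_set_image, e.injective.mem_set_image, h hr x (by rw [← he, hy])]
  · have : Nonempty (Fin k) := Fin.pos_iff_nonempty.1 (Nat.pos_of_ne_zero hk)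
    rw [zero_mul, homothety_zero, const_apply]
    refine sliceRoot_eq_zero hk (Subsingleton.measure_zero ?_ _)
    have hunique : ∀ z, (inner ℝ v w, z) ∈ e '' K → z = (e v).2 := by
      rintro z ⟨x, hx, hxz⟩
      rw [← hv x hx (by rw [← he, hxz]), hxz]
    exact fun z hz z' hz' => (hunique z hz).trans (hunique z' hz').symm

namespace IsTentDirection

lemma sliceRoot_eq_zero_of_lt (h : IsTentDirection T i j w m) (hk : k ≠ 0)
    (he : ∀ x, (e x).1 = inner ℝ x w) {t : ℝ} (ht : t < inner ℝ (T.points i) w) :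
    sliceRoot (e '' solidSimplex T) t = 0 := by
  refine sliceRoot_eq_zero_of_forall_fst_ne hk (forall_mem_image.2 fun x hx => ?_)
  exact he x ▸ (ht.trans_le (h.le_inner hx)).ne'

lemma sliceRoot_eq_zero_of_gt (h : IsTentDirection T i j w m) (hk : k ≠ 0)
    (he : ∀ x, (e x).1 = inner ℝ x w) {t : ℝ} (ht : inner ℝ (T.points j) w < t) :
    sliceRoot (e '' solidSimplex T) t = 0 := by
  refine sliceRoot_eq_zero_of_forall_fst_ne hk (forall_mem_image.2 fun x hx => ?_)
  exact he x ▸ ((h.inner_le hx).trans_lt ht).ne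

lemma convexOn_Iic_sliceRoot (h : IsTentDirection T i j w m) (hk : k ≠ 0)
    (he : ∀ x, (e x).1 = inner ℝ x w) : ConvexOn ℝ (Iic m) (sliceRoot (e '' solidSimplex T)) :=
  convexOn_Iic_of_affine_of_eq_zero h.le sliceRoot_nonneg
    (fun _ => h.sliceRoot_eq_zero_of_lt hk he) fun hi _ hr hr₁ =>
      sliceRoot_image_homothety hk he (fun _ => h.eq_of_inner_eq hi) hr fun hr _ =>
        h.homothety_mem_iff hi hr hr₁

lemma convexOn_Ici_sliceRoot (h : IsTentDirection T i j w m) (hk : k ≠ 0)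
    (he : ∀ x, (e x).1 = inner ℝ x w) :
    ConvexOn ℝ (Ici m) (sliceRoot (e '' solidSimplex T)) := by
  have hneg : ConvexOn ℝ (Iic (-m)) fun t => sliceRoot (e '' solidSimplex T) (-t) := by
    refine convexOn_Iic_of_affine_of_eq_zero (neg_le_neg h.ge) (fun _ => sliceRoot_nonneg _)
      (fun t ht => h.sliceRoot_eq_zero_of_gt hk he (lt_neg.1 ht)) fun hj r hr hr₁ => ?_
    have hj' : inner ℝ (T.points j) (-w) < -m := by rwa [inner_neg_right]
    rw [neg_neg, ← sliceRoot_image_homothety hk he (v := T.points j)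
      (fun x hx hxj => h.neg.eq_of_inner_eq hj' hx (by simpa using hxj)) hr fun hr x hx =>
        h.neg.homothety_mem_iff hj' hr hr₁ (by rw [inner_neg_right, hx])]
    congr 1
    simp only [homothety_apply, vsub_eq_sub, vadd_eq_add, smul_eq_mul]
    ring
  refine ((hneg.comp_linearMap (-LinearMap.id)).subset (fun _ ht => neg_le_neg (α := ℝ) ht)
    (convex_Ici m)).congr fun t _ => ?_
  exact congrArg (sliceRoot (e '' solidSimplex T)) (neg_neg t)

lemma exists_hasCenteredPowDensity_convexOn (h : IsTentDirection T i j w m) (hk : k ≠ 0)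
    (hT₀ : IsCentered (solidSimplex T)) (hw : w ≠ 0) :
    ∃ γ, HasCenteredPowDensity (marginalLaw (solidSimplex T) w) k γ ∧
      ConvexOn ℝ (Iic m) γ ∧ ConvexOn ℝ (Ici m) γ ∧
      (inner ℝ (T.points j) w = m → ∀ t > m, γ t = 0) := by
  obtain ⟨e, he⟩ := exists_continuousLinearEquiv_fst_eq_inner hw
  exact ⟨_, (isConvexBody_solidSimplex T).hasCenteredPowDensity_sliceRoot hT₀ hk he,
    h.convexOn_Iic_sliceRoot hk he, h.convexOn_Ici_sliceRoot hk he,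
    fun hj t ht => h.sliceRoot_eq_zero_of_gt hk he (hj.trans_lt ht)⟩

end IsTentDirection

end

end Simplex

section Comparison

section

variable {n : ℕ} {p q : ℝ}

/-- The `p`-moments of the marginal `X · θ` on the two half-lines agree with those of the marginal
`Y · w`, its `q`-moments there are at most those of `Y · w`, and if these agree too then so do the
laws. Here `X` is uniform on `K` and `Y` is uniform on `L`. -/
structure IsDominatedMarginal (p q : ℝ) (K : Set (EuclideanSpace ℝ (Fin n)))
    (θ : EuclideanSpace ℝ (Fin n)) (L : Set (EuclideanSpace ℝ (Fin n)))
    (w : EuclideanSpace ℝ (Fin n)) : Prop where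
  pos_eq : posPartMoment p K θ = posPartMoment p L w
  neg_eq : posPartMoment p K (-θ) = posPartMoment p L (-w)
  pos_le : posPartMoment q K θ ≤ posPartMoment q L w
  neg_le : posPartMoment q K (-θ) ≤ posPartMoment q L (-w)
  marginalLaw_eq : posPartMoment q K θ = posPartMoment q L w →
    posPartMoment q K (-θ) = posPartMoment q L (-w) → marginalLaw K θ = marginalLaw L w

lemma isDominatedMarginal_of_marginalLaw_eq {K L : Set (EuclideanSpace ℝ (Fin n))}
    {θ w : EuclideanSpace ℝ (Fin n)} (hp : 0 ≤ p) (hq : 0 ≤ q)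
    (h : marginalLaw K θ = marginalLaw L w) : IsDominatedMarginal p q K θ L w := by
  have hpos : ∀ r : ℝ, 0 ≤ r → posPartMoment r K θ = posPartMoment r L w := fun r hr => by
    rw [posPartMoment_eq_integral_marginalLaw hr, h, posPartMoment_eq_integral_marginalLaw hr]
  have hneg : ∀ r : ℝ, 0 ≤ r → posPartMoment r K (-θ) = posPartMoment r L (-w) := fun r hr => by
    rw [posPartMoment_eq_integral_marginalLaw hr, marginalLaw_neg, h, ← marginalLaw_neg,
      posPartMoment_eq_integral_marginalLaw hr]
  exact ⟨hpos p hp, hneg p hp, (hpos q hq).le, (hneg q hq).le, fun _ _ => h⟩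

end

lemma exists_pos_rpow_mul_eq {p a b : ℝ} (hp : p ≠ 0) (ha : 0 < a) (hb : 0 < b) :
    ∃ c : ℝ, 0 < c ∧ c ^ p * a = b :=
  ⟨(b / a) ^ p⁻¹, by positivity, by
    rw [Real.rpow_inv_rpow (by positivity) hp, div_mul_cancel₀ b ha.ne']⟩

section

variable {k : ℕ} {K : Set (EuclideanSpace ℝ (Fin (k + 1)))} {θ w : EuclideanSpace ℝ (Fin (k + 1))}
  {T : Affine.Simplex ℝ (EuclideanSpace ℝ (Fin (k + 1))) (k + 1)} {i j : Fin (k + 1 + 1)} {m : ℝ}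
  {p q : ℝ}

lemma IsConvexBody.posPartMoment_pos (hK : IsConvexBody K) (hK₀ : IsCentered K) (hk : k ≠ 0)
    (hθ : θ ≠ 0) (hp : 0 < p) : 0 < posPartMoment p K θ := by
  obtain ⟨φ, hφ, -⟩ := hK.exists_hasCenteredPowDensity_concaveOnPos hK₀ hk hθ
  rw [hφ.posPartMoment_eq hp]
  exact hφ.posMoment_pos hp.le

namespace IsTentDirection

theorem isDominatedMarginal (h : IsTentDirection T i j w m) (hK : IsConvexBody K)
    (hK₀ : IsCentered K) (hT₀ : IsCentered (solidSimplex T)) (hk : k ≠ 0) (hθ : θ ≠ 0)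
    (hw : w ≠ 0) (hp : 1 < p) (hpq : p < q)
    (hpos : posPartMoment p K θ = posPartMoment p (solidSimplex T) w)
    (hneg : posPartMoment p K (-θ) = posPartMoment p (solidSimplex T) (-w)) :
    IsDominatedMarginal p q K θ (solidSimplex T) w := by
  have hp₀ : 0 < p := zero_lt_one.trans hp
  have hq₀ : 0 < q := hp₀.trans hpq
  obtain ⟨φ, hφ, hconc⟩ := hK.exists_hasCenteredPowDensity_concaveOnPos hK₀ hk hθ
  obtain ⟨γ, hγ, hl, hr, -⟩ := h.exists_hasCenteredPowDensity_convexOn hk hT₀ hw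
  obtain ⟨hpos_le, hneg_le, htail⟩ := hφ.posMoment_le_and_integral_Ioi_eq
    hγ.toIsCenteredPowDensity hconc hl hr hp hpq
    (by rw [← hφ.posPartMoment_eq hp₀, ← hγ.posPartMoment_eq hp₀, hpos])
    (by rw [← hφ.posPartMoment_neg_eq hp₀, ← hγ.posPartMoment_neg_eq hp₀, hneg])
  rw [← hφ.posPartMoment_eq hq₀, ← hγ.posPartMoment_eq hq₀] at hpos_le htail
  rw [← hφ.posPartMoment_neg_eq hq₀, ← hγ.posPartMoment_neg_eq hq₀] at hneg_le htail
  exact ⟨hpos, hneg, hpos_le, hneg_le, fun hpos_eq hneg_eq =>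
    hφ.measure_eq_of_integral_Ioi_eq hγ (htail hpos_eq hneg_eq)⟩

theorem posPartMoment_mul_le (h : IsTentDirection T i j w m) (hj : inner ℝ (T.points j) w = m)
    (hK : IsConvexBody K) (hK₀ : IsCentered K) (hT₀ : IsCentered (solidSimplex T)) (hk : k ≠ 0)
    (hθ : θ ≠ 0) (hw : w ≠ 0) (hp : 1 < p) :
    posPartMoment p (solidSimplex T) w * posPartMoment p K (-θ) ≤
      posPartMoment p (solidSimplex T) (-w) * posPartMoment p K θ := by
  have hp₀ : 0 < p := zero_lt_one.trans hp
  have hTneg := (isConvexBody_solidSimplex T).posPartMoment_pos hT₀ hk (neg_ne_zero.2 hw) hp₀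
  obtain ⟨c, hc, hmatch⟩ := exists_pos_rpow_mul_eq hp₀.ne' hTneg
    (hK.posPartMoment_pos hK₀ hk (neg_ne_zero.2 hθ) hp₀)
  obtain ⟨φ, hφ, hconc⟩ := hK.exists_hasCenteredPowDensity_concaveOnPos hK₀ hk hθ
  obtain ⟨γ, hγ, hl, -, hr⟩ := (h.smul hc.le).exists_hasCenteredPowDensity_convexOn hk hT₀
    (smul_ne_zero hc.ne' hw)
  have hneg : posMoment p (fun t => γ (-t) ^ k) = posMoment p fun t => φ (-t) ^ k := by
    rw [← hφ.posPartMoment_neg_eq hp₀, ← hγ.posPartMoment_neg_eq hp₀, ← smul_neg,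
      posPartMoment_smul hc.le, hmatch]
  have hle := hφ.posMoment_le_of_eq_zero hγ.toIsCenteredPowDensity hconc hl
    (hr (by rw [inner_smul_right, hj])) hp hneg
  rw [← hφ.posPartMoment_eq hp₀, ← hγ.posPartMoment_eq hp₀, posPartMoment_smul hc.le] at hle
  calc posPartMoment p (solidSimplex T) w * posPartMoment p K (-θ)
      = posPartMoment p (solidSimplex T) (-w) * (c ^ p * posPartMoment p (solidSimplex T) w) := by
        rw [← hmatch]; ring
    _ ≤ _ := mul_le_mul_of_nonneg_left hle hTneg.le

end IsTentDirection

end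

section

variable {n : ℕ} {T : Affine.Simplex ℝ (EuclideanSpace ℝ (Fin n)) n} {i j : Fin (n + 1)}
  {u v : EuclideanSpace ℝ (Fin n)}

namespace IsOuterUnitNormal

lemma ne_zero (hu : IsOuterUnitNormal T i u) : u ≠ 0 :=
  norm_ne_zero_iff.1 (hu.1.trans_ne one_ne_zero)

lemma isTentDirection (hu : IsOuterUnitNormal T i u) (hij : i ≠ j) :
    IsTentDirection T i j u (inner ℝ (T.points j) u) := by
  obtain ⟨-, a, ha, hai⟩ := hu
  exact ⟨hij, fun l hi _ => by rw [ha l hi, ha j hij.symm], hai.le.trans_eq (ha j hij.symm).symm,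
    le_rfl⟩

lemma exists_isTentDirection_sub (hu : IsOuterUnitNormal T i u) (hv : IsOuterUnitNormal T j v)
    (hij : i ≠ j) {s : ℝ} (hs : s ∈ Set.Icc (0 : ℝ) 1) :
    ∃ m, IsTentDirection T i j (s • u - (1 - s) • v) m := by
  obtain ⟨-, a, ha, hai⟩ := hu
  obtain ⟨-, b, hb, hbj⟩ := hv
  refine ⟨s * a - (1 - s) * b, hij, fun l hi hj => ?_, ?_, ?_⟩ <;>
    rw [inner_sub_right, inner_smul_right, inner_smul_right]
  · rw [ha l hi, hb l hj]
  · rw [hb i hij]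
    exact sub_le_sub_right (mul_le_mul_of_nonneg_left hai.le hs.1) _
  · rw [ha j hij.symm]
    exact sub_le_sub_left (mul_le_mul_of_nonneg_left hbj.le (sub_nonneg.2 hs.2)) _

lemma smul_sub_smul_ne_zero (hu : IsOuterUnitNormal T i u) (hv : IsOuterUnitNormal T j v)
    (hn : 2 ≤ n) (hij : i ≠ j) (s : ℝ) : s • u - (1 - s) • v ≠ 0 := by
  intro hzero
  obtain ⟨l, hli, hlj⟩ := Fin.exists_ne_and_ne_of_two_lt i j (by omega)
  have hv₀ := hv.ne_zero
  obtain ⟨-, a, ha, hai⟩ := hu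
  obtain ⟨-, b, hb, -⟩ := hv
  have hinner : ∀ l, s * inner ℝ (T.points l) u = (1 - s) * inner ℝ (T.points l) v := fun l => by
    rw [← inner_smul_right, ← inner_smul_right, sub_eq_zero.1 hzero]
  have hs : s * (a - inner ℝ (T.points i) u) = 0 := by
    rw [mul_sub, ← ha l hli, hinner, hinner, hb l hlj, hb i hij, sub_self]
  obtain rfl : s = 0 := (mul_eq_zero.1 hs).resolve_right (sub_pos.2 hai).ne'
  simp [hv₀] at hzero

end IsOuterUnitNormal

end

section

variable {k : ℕ} {K : Set (EuclideanSpace ℝ (Fin (k + 1)))} {θ : EuclideanSpace ℝ (Fin (k + 1))}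
  {T : Affine.Simplex ℝ (EuclideanSpace ℝ (Fin (k + 1))) (k + 1)} {i j : Fin (k + 1 + 1)}
  {u v : EuclideanSpace ℝ (Fin (k + 1))} {p q : ℝ}

/-- The ratio of the two half-line `p`-moments is least at `u` and greatest at `-v`, hence takes
the value prescribed by `K` in between; the scale `c` then adjusts both moments at once. -/
theorem exists_posPartMoment_eq (hk : k ≠ 0) (hK : IsConvexBody K) (hK₀ : IsCentered K)
    (hT₀ : IsCentered (solidSimplex T)) (hθ : θ ≠ 0) (hu : IsOuterUnitNormal T i u)
    (hv : IsOuterUnitNormal T j v) (hij : i ≠ j) (hp : 1 < p) :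
    ∃ s ∈ Set.Icc (0 : ℝ) 1, ∃ c : ℝ, 0 < c ∧
      posPartMoment p K θ = posPartMoment p (solidSimplex T) (c • (s • u - (1 - s) • v)) ∧
      posPartMoment p K (-θ) = posPartMoment p (solidSimplex T) (-(c • (s • u - (1 - s) • v))) := by
  have hp₀ : 0 < p := zero_lt_one.trans hp
  have hT := isConvexBody_solidSimplex T
  let w : ℝ → EuclideanSpace ℝ (Fin (k + 1)) := fun s => s • u - (1 - s) • v
  let F : ℝ → ℝ := fun s => posPartMoment p (solidSimplex T) (w s) * posPartMoment p K (-θ) -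
    posPartMoment p (solidSimplex T) (-w s) * posPartMoment p K θ
  have hwc : Continuous w := by fun_prop
  have hmoment := hT.continuous_posPartMoment hp₀.le
  have hFc : Continuous F := ((hmoment.comp hwc).mul continuous_const).sub
    ((hmoment.comp hwc.neg).mul continuous_const)
  have hF₀ : 0 ≤ F 0 := by
    have := (hv.isTentDirection hij.symm).posPartMoment_mul_le rfl hK hK₀ hT₀ hk
      (neg_ne_zero.2 hθ) hv.ne_zero hp
    simpa [F, w] using this
  have hF₁ : F 1 ≤ 0 := by
    have := (hu.isTentDirection hij).posPartMoment_mul_le rfl hK hK₀ hT₀ hk hθ hu.ne_zero hp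
    simpa [F, w] using this
  obtain ⟨s, hs, hFs⟩ := intermediate_value_Icc' zero_le_one hFc.continuousOn ⟨hF₁, hF₀⟩
  have hTpos : 0 < posPartMoment p (solidSimplex T) (w s) :=
    hT.posPartMoment_pos hT₀ hk (hu.smul_sub_smul_ne_zero hv (by omega) hij s) hp₀
  obtain ⟨c, hc, hcpos⟩ := exists_pos_rpow_mul_eq hp₀.ne' hTpos
    (hK.posPartMoment_pos hK₀ hk hθ hp₀)
  refine ⟨s, hs, c, hc, ?_, ?_⟩
  · rw [posPartMoment_smul hc.le, hcpos]
  · rw [← smul_neg, posPartMoment_smul hc.le]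
    refine mul_left_cancel₀ hTpos.ne' ?_
    rw [sub_eq_zero.1 hFs, ← hcpos]
    ring

lemma exists_isDominatedMarginal_smul_of_ne_zero (hk : k ≠ 0) (hp : 1 < p) (hpq : p < q)
    (hK : IsConvexBody K) (hK₀ : IsCentered K) (hT₀ : IsCentered (solidSimplex T)) (hθ : θ ≠ 0)
    (hu : IsOuterUnitNormal T i u) (hv : IsOuterUnitNormal T j v) (hij : i ≠ j) :
    ∃ s ∈ Set.Icc (0 : ℝ) 1, s • u - (1 - s) • v ≠ 0 ∧ ∃ c : ℝ, 0 < c ∧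
      IsDominatedMarginal p q K θ (solidSimplex T) (c • (s • u - (1 - s) • v)) := by
  obtain ⟨s, hs, c, hc, hpos, hneg⟩ := exists_posPartMoment_eq hk hK hK₀ hT₀ hθ hu hv hij hp
  have hne := hu.smul_sub_smul_ne_zero hv (by omega) hij s
  obtain ⟨m, hm⟩ := hu.exists_isTentDirection_sub hv hij hs
  exact ⟨s, hs, hne, c, hc, (hm.smul hc.le).isDominatedMarginal hK hK₀ hT₀ hk hθ
    (smul_ne_zero hc.ne' hne) hp hpq hpos hneg⟩

end

section DimensionOne

lemma integral_id_cond_Icc {a b : ℝ} (hab : a < b) :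
    ∫ t, t ∂(cond volume (Set.Icc a b)) = (a + b) / 2 := by
  have hne : b - a ≠ 0 := (sub_pos.2 hab).ne'
  rw [ProbabilityTheory.cond, integral_smul_measure, integral_Icc_eq_integral_Ioc,
    ← intervalIntegral.integral_of_le hab.le, integral_id, Real.volume_Icc, ENNReal.toReal_inv,
    ENNReal.toReal_ofReal (sub_nonneg.2 hab.le), smul_eq_mul]
  field_simp
  ring

lemma map_mul_left_cond_Icc {c : ℝ} (hc : 0 < c) (a b : ℝ) :
    (cond volume (Set.Icc a b)).map (fun t => c * t) =
      cond volume (Set.Icc (c * a) (c * b)) := by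
  rw [← Set.image_mul_left_Icc' hc]
  exact map_cond_continuousLinearEquiv volume volume
    (ContinuousLinearEquiv.smulLeft (Units.mk0 c hc.ne')) (Set.Icc a b)

variable {K L : Set (EuclideanSpace ℝ (Fin 1))} {θ w : EuclideanSpace ℝ (Fin 1)}

namespace IsConvexBody

lemma exists_marginalLaw_eq_cond_Icc (hK : IsConvexBody K) (hθ : θ ≠ 0) :
    ∃ a b : ℝ, a < b ∧ marginalLaw K θ = cond volume (Set.Icc a b) := by
  obtain ⟨e₀, he₀⟩ := exists_continuousLinearEquiv_fst_eq_inner (k := 0) hθ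
  let e : EuclideanSpace ℝ (Fin 1) ≃L[ℝ] ℝ :=
    e₀.trans (LinearEquiv.prodUnique (R := ℝ) (M := ℝ) (M₂ := Fin 0 → ℝ)).toContinuousLinearEquiv
  have hlaw : marginalLaw K θ = cond volume (e '' K) := by
    rw [← map_cond_continuousLinearEquiv volume volume e K, marginalLaw, uniformLaw]
    congr 1 with x
    exact (he₀ x).symm
  have hinterior : (interior (e '' K)).Nonempty := by
    have := hK.nonempty_interior.image e.toHomeomorph
    rwa [e.toHomeomorph.image_interior] at this
  have hconvex : Convex ℝ (e '' K) := hK.convex.linear_image e.toLinearEquiv.toLinearMap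
  have hIcc := eq_Icc_of_connected_compact
    ⟨hinterior.mono interior_subset, hconvex.isPreconnected⟩ (hK.isCompact.image e.continuous)
  rw [hIcc, interior_Icc, Set.nonempty_Ioo] at hinterior
  exact ⟨_, _, hinterior, hIcc ▸ hlaw⟩

lemma exists_marginalLaw_eq_cond_Icc_neg (hK : IsConvexBody K) (hK₀ : IsCentered K)
    (hθ : θ ≠ 0) : ∃ r : ℝ, 0 < r ∧ marginalLaw K θ = cond volume (Set.Icc (-r) r) := by
  obtain ⟨a, b, hab, hlaw⟩ := hK.exists_marginalLaw_eq_cond_Icc hθ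
  have hmean := hK.integral_marginalLaw_eq_zero hK₀ θ
  rw [hlaw, integral_id_cond_Icc hab] at hmean
  obtain rfl : a = -b := by linarith
  exact ⟨b, by linarith, hlaw⟩

lemma exists_marginalLaw_eq_smul (hK : IsConvexBody K) (hK₀ : IsCentered K)
    (hL : IsConvexBody L) (hL₀ : IsCentered L) (hθ : θ ≠ 0) (hw : w ≠ 0) :
    ∃ c : ℝ, 0 < c ∧ marginalLaw K θ = marginalLaw L (c • w) := by
  obtain ⟨r, hr, hlaw⟩ := hK.exists_marginalLaw_eq_cond_Icc_neg hK₀ hθ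
  obtain ⟨r', hr', hlaw'⟩ := hL.exists_marginalLaw_eq_cond_Icc_neg hL₀ hw
  refine ⟨r / r', div_pos hr hr', ?_⟩
  rw [marginalLaw_smul, hlaw', map_mul_left_cond_Icc (div_pos hr hr'), hlaw, mul_neg,
    div_mul_cancel₀ r hr'.ne']

end IsConvexBody

end DimensionOne

end Comparison

section NormRatio

section

variable {n : ℕ} {u v : EuclideanSpace ℝ (Fin n)} {s : ℝ}

lemma norm_smul_interpDirection (u v : EuclideanSpace ℝ (Fin n)) (s : ℝ) :
    ‖s • u - (1 - s) • v‖ • interpDirection u v s = s • u - (1 - s) • v :=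
  NormedSpace.norm_smul_normalize _

lemma interpDirection_mem_sphere (h : s • u - (1 - s) • v ≠ 0) :
    interpDirection u v s ∈ Metric.sphere 0 1 := by
  rw [mem_sphere_zero_iff_norm]
  exact NormedSpace.norm_normalize_eq_one_iff.2 h

end

section

variable {n : ℕ} {K : Set (EuclideanSpace ℝ (Fin n))}
  {T : Affine.Simplex ℝ (EuclideanSpace ℝ (Fin n)) n} {i j : Fin (n + 1)}
  {u v θ : EuclideanSpace ℝ (Fin n)} {p q : ℝ}

theorem exists_isDominatedMarginal_smul_interpDirection (hn : 1 ≤ n) (hp : 1 < p) (hpq : p < q)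
    (hK : IsConvexBody K) (hK₀ : IsCentered K) (hT₀ : IsCentered (solidSimplex T)) (hθ : θ ≠ 0)
    (hu : IsOuterUnitNormal T i u) (hv : IsOuterUnitNormal T j v) (hij : i ≠ j) :
    ∃ s ∈ Set.Icc (0 : ℝ) 1, interpDirection u v s ∈ Metric.sphere 0 1 ∧ ∃ c : ℝ, 0 < c ∧
      IsDominatedMarginal p q K θ (solidSimplex T) (c • interpDirection u v s) := by
  suffices h : ∃ s ∈ Set.Icc (0 : ℝ) 1, s • u - (1 - s) • v ≠ 0 ∧ ∃ c : ℝ, 0 < c ∧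
      IsDominatedMarginal p q K θ (solidSimplex T) (c • (s • u - (1 - s) • v)) by
    obtain ⟨s, hs, hne, c, hc, hdom⟩ := h
    refine ⟨s, hs, interpDirection_mem_sphere hne, c * ‖s • u - (1 - s) • v‖,
      mul_pos hc (norm_pos_iff.2 hne), ?_⟩
    rwa [mul_smul, norm_smul_interpDirection]
  obtain ⟨k, rfl⟩ := Nat.exists_eq_add_of_le' hn
  rcases eq_or_ne k 0 with rfl | hk
  · have hne : (0 : ℝ) • u - (1 - 0 : ℝ) • v ≠ 0 := by simpa using hv.ne_zero
    obtain ⟨c, hc, hlaw⟩ :=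
      hK.exists_marginalLaw_eq_smul hK₀ (isConvexBody_solidSimplex T) hT₀ hθ hne
    exact ⟨0, Set.left_mem_Icc.2 zero_le_one, hne, c, hc,
      isDominatedMarginal_of_marginalLaw_eq (by linarith) (by linarith) hlaw⟩
  · exact exists_isDominatedMarginal_smul_of_ne_zero hk hp hpq hK hK₀ hT₀ hθ hu hv hij

end

/-- The moment `E |X · θ| ^ p` for `X` uniform on `K`. -/
noncomputable def absMoment {n : ℕ} (p : ℝ) (K : Set (EuclideanSpace ℝ (Fin n)))
    (θ : EuclideanSpace ℝ (Fin n)) : ℝ :=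
  ∫ x, |inner ℝ x θ| ^ p ∂(uniformLaw K)

section

variable {n : ℕ} {K L : Set (EuclideanSpace ℝ (Fin n))} {θ w : EuclideanSpace ℝ (Fin n)} {p q : ℝ}

lemma uniformLaw_orthogonal_eq_zero (hθ : θ ≠ 0) : uniformLaw K (ℝ ∙ θ)ᗮ = 0 := by
  refine cond_absolutelyContinuous (Measure.addHaar_submodule volume _ ?_)
  rwa [Ne, Submodule.orthogonal_eq_top_iff, Submodule.span_singleton_eq_bot]

lemma absMoment_nonneg (θ : EuclideanSpace ℝ (Fin n)) : 0 ≤ absMoment p K θ :=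
  integral_nonneg fun _ => Real.rpow_nonneg (abs_nonneg _) _

lemma normRatio_smul {c : ℝ} (hc : c ≠ 0) : normRatio p q K (c • θ) = normRatio p q K θ := by
  have hscale : ∀ r, eLpNorm (fun x => inner ℝ x (c • θ)) r (uniformLaw K) =
      ‖c‖ₑ * eLpNorm (fun x => inner ℝ x θ) r (uniformLaw K) := fun r => by
    rw [← eLpNorm_const_smul]
    congr 1 with x
    exact inner_smul_right x θ c
  rw [normRatio, hscale, hscale, ENNReal.toReal_mul, ENNReal.toReal_mul, toReal_enorm,
    mul_div_mul_left _ _ (norm_ne_zero_iff.2 hc), normRatio]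

namespace IsConvexBody

lemma posPartMoment_add_neg (hK : IsConvexBody K) (hp : 0 < p) (θ : EuclideanSpace ℝ (Fin n)) :
    posPartMoment p K θ + posPartMoment p K (-θ) = absMoment p K θ := by
  have hint : ∀ w : EuclideanSpace ℝ (Fin n),
      Integrable (fun x => max (inner ℝ x w) 0 ^ p) (uniformLaw K) := fun w =>
    hK.integrable_uniformLaw <| Continuous.rpow_const (by fun_prop) fun _ => .inr hp.le
  rw [posPartMoment, posPartMoment, absMoment, ← integral_add (hint θ) (hint (-θ))]
  congr 1 with x
  rw [inner_neg_right]
  rcases le_total 0 (inner ℝ x θ) with h | h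
  · rw [max_eq_left h, max_eq_right (neg_nonpos.2 h), Real.zero_rpow hp.ne', abs_of_nonneg h,
      add_zero]
  · rw [max_eq_right h, max_eq_left (neg_nonneg.2 h), Real.zero_rpow hp.ne', abs_of_nonpos h,
      zero_add]

lemma absMoment_pos (hK : IsConvexBody K) (hp : 0 < p) (hθ : θ ≠ 0) : 0 < absMoment p K θ := by
  have hprob := hK.isProbabilityMeasure
  have hcont : Continuous fun x : EuclideanSpace ℝ (Fin n) => |inner ℝ x θ| ^ p :=
    Continuous.rpow_const (by fun_prop) fun _ => .inr hp.le
  have hsupport : Function.support (fun x : EuclideanSpace ℝ (Fin n) => |inner ℝ x θ| ^ p) =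
      ((ℝ ∙ θ)ᗮ : Set (EuclideanSpace ℝ (Fin n)))ᶜ := by
    ext x
    simp [Submodule.mem_orthogonal_singleton_iff_inner_left, Real.rpow_eq_zero, hp.ne']
  rw [absMoment, integral_pos_iff_support_of_nonneg (fun _ => by positivity)
    (hK.integrable_uniformLaw hcont), hsupport,
    (prob_compl_eq_one_iff (Submodule.closed_of_finiteDimensional _).measurableSet).2
      (uniformLaw_orthogonal_eq_zero hθ)]
  exact zero_lt_one

lemma toReal_eLpNorm_inner (hK : IsConvexBody K) (hp : 0 < p) (θ : EuclideanSpace ℝ (Fin n)) :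
    (eLpNorm (fun x => inner ℝ x θ) (ENNReal.ofReal p) (uniformLaw K)).toReal =
      absMoment p K θ ^ p⁻¹ := by
  have hp₀ : ENNReal.ofReal p ≠ 0 := (ENNReal.ofReal_pos.2 hp).ne'
  have hcont : Continuous fun x : EuclideanSpace ℝ (Fin n) => inner ℝ x θ := by fun_prop
  have hmem : MemLp (fun x => inner ℝ x θ) (ENNReal.ofReal p) (uniformLaw K) := by
    rw [← integrable_norm_rpow_iff hcont.aestronglyMeasurable hp₀ ENNReal.ofReal_ne_top,
      ENNReal.toReal_ofReal hp.le]
    exact hK.integrable_uniformLaw (hcont.norm.rpow_const fun _ => .inr hp.le)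
  rw [hmem.eLpNorm_eq_integral_rpow_norm hp₀ ENNReal.ofReal_ne_top, ENNReal.toReal_ofReal hp.le]
  exact ENNReal.toReal_ofReal (Real.rpow_nonneg (absMoment_nonneg θ) _)

lemma normRatio_eq (hK : IsConvexBody K) (hp : 0 < p) (hq : 0 < q)
    (θ : EuclideanSpace ℝ (Fin n)) :
    normRatio p q K θ = absMoment q K θ ^ q⁻¹ / absMoment p K θ ^ p⁻¹ := by
  rw [normRatio, hK.toReal_eLpNorm_inner hp, hK.toReal_eLpNorm_inner hq]

lemma continuousOn_normRatio (hK : IsConvexBody K) (hp : 0 < p) (hq : 0 < q) :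
    ContinuousOn (normRatio p q K) {0}ᶜ := by
  have hcont : ∀ {r : ℝ}, 0 < r → Continuous fun θ => absMoment r K θ ^ r⁻¹ := fun hr =>
    (hK.continuous_integral_inner (continuous_abs.rpow_const fun _ => .inr hr.le)).rpow_const
      fun _ => .inr (inv_nonneg.2 hr.le)
  refine ((hcont hq).continuousOn.div (hcont hp).continuousOn fun θ hθ => ?_).congr
    fun θ _ => hK.normRatio_eq hp hq θ
  exact (Real.rpow_pos_of_pos (hK.absMoment_pos hp hθ) _).ne'

lemma isGreatest_alpha (hn : 1 ≤ n) (hK : IsConvexBody K) (hp : 0 < p) (hq : 0 < q) :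
    IsGreatest (normRatio p q K '' Metric.sphere 0 1) (alpha p q K) := by
  have : Nonempty (Fin n) := Fin.pos_iff_nonempty.1 hn
  have hsphere : Metric.sphere (0 : EuclideanSpace ℝ (Fin n)) 1 ⊆ {0}ᶜ := fun _ hθ =>
    ne_zero_of_mem_unit_sphere ⟨_, hθ⟩
  exact ((isCompact_sphere _ _).image_of_continuousOn
    ((hK.continuousOn_normRatio hp hq).mono hsphere)).isGreatest_sSup
      ((NormedSpace.sphere_nonempty.2 zero_le_one).image _)

end IsConvexBody

namespace IsDominatedMarginal

lemma absMoment_eq (h : IsDominatedMarginal p q K θ L w) (hK : IsConvexBody K)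
    (hL : IsConvexBody L) (hp : 0 < p) : absMoment p K θ = absMoment p L w := by
  rw [← hK.posPartMoment_add_neg hp, ← hL.posPartMoment_add_neg hp, h.pos_eq, h.neg_eq]

lemma absMoment_le (h : IsDominatedMarginal p q K θ L w) (hK : IsConvexBody K)
    (hL : IsConvexBody L) (hq : 0 < q) : absMoment q K θ ≤ absMoment q L w := by
  rw [← hK.posPartMoment_add_neg hq, ← hL.posPartMoment_add_neg hq]
  exact add_le_add h.pos_le h.neg_le

lemma marginalLaw_eq_of_absMoment_eq (h : IsDominatedMarginal p q K θ L w) (hK : IsConvexBody K)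
    (hL : IsConvexBody L) (hq : 0 < q) (heq : absMoment q K θ = absMoment q L w) :
    marginalLaw K θ = marginalLaw L w := by
  rw [← hK.posPartMoment_add_neg hq, ← hL.posPartMoment_add_neg hq] at heq
  obtain ⟨hpos, hneg⟩ := (add_eq_add_iff_eq_and_eq h.pos_le h.neg_le).1 heq
  exact h.marginalLaw_eq hpos hneg

lemma normRatio_le (h : IsDominatedMarginal p q K θ L w) (hK : IsConvexBody K)
    (hL : IsConvexBody L) (hp : 0 < p) (hq : 0 < q) : normRatio p q K θ ≤ normRatio p q L w := by
  rw [hK.normRatio_eq hp hq, hL.normRatio_eq hp hq, h.absMoment_eq hK hL hp]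
  exact div_le_div_of_nonneg_right (Real.rpow_le_rpow (absMoment_nonneg θ)
    (h.absMoment_le hK hL hq) (inv_nonneg.2 hq.le)) (Real.rpow_nonneg (absMoment_nonneg w) _)

lemma marginalLaw_eq_of_normRatio_eq (h : IsDominatedMarginal p q K θ L w) (hK : IsConvexBody K)
    (hL : IsConvexBody L) (hp : 0 < p) (hq : 0 < q) (hθ : θ ≠ 0)
    (heq : normRatio p q K θ = normRatio p q L w) : marginalLaw K θ = marginalLaw L w := by
  have hden := Real.rpow_pos_of_pos (hK.absMoment_pos hp hθ) p⁻¹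
  rw [hK.normRatio_eq hp hq, hL.normRatio_eq hp hq, ← h.absMoment_eq hK hL hp,
    div_left_inj' hden.ne', Real.rpow_left_inj (absMoment_nonneg θ) (absMoment_nonneg w)
      (inv_ne_zero hq.ne')] at heq
  exact h.marginalLaw_eq_of_absMoment_eq hK hL hq heq

end IsDominatedMarginal

end

lemma exists_inner_add_eq_affineMap {E : Type*} [NormedAddCommGroup E] [InnerProductSpace ℝ E]
    [FiniteDimensional ℝ E] (f : E →ᵃ[ℝ] ℝ) : ∃ a : E, ∀ x, f x = inner ℝ x a + f 0 := by
  have := FiniteDimensional.complete ℝ E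
  refine ⟨(InnerProductSpace.toDual ℝ E).symm (LinearMap.toContinuousLinearMap f.linear),
    fun x => ?_⟩
  rw [real_inner_comm, InnerProductSpace.toDual_symm_apply]
  simpa using congrFun f.decomp x

section

variable {n : ℕ} {K : Set (EuclideanSpace ℝ (Fin n))}
  {T : Affine.Simplex ℝ (EuclideanSpace ℝ (Fin n)) n} {i j : Fin (n + 1)}
  {u v θ : EuclideanSpace ℝ (Fin n)} {p q : ℝ}

lemma exists_isOuterUnitNormal (hn : 1 ≤ n) (T : Affine.Simplex ℝ (EuclideanSpace ℝ (Fin n)) n)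
    (i : Fin (n + 1)) : ∃ u, IsOuterUnitNormal T i u := by
  obtain ⟨a, ha⟩ := exists_inner_add_eq_affineMap ((simplexBasis T).coord i)
  have hi : inner ℝ (T.points i) a = 1 - (simplexBasis T).coord i 0 := by
    have hone : (simplexBasis T).coord i (T.points i) = 1 := (simplexBasis T).coord_apply_eq i
    rw [← hone, ha (T.points i), add_sub_cancel_right]
  have hl : ∀ l ≠ i, inner ℝ (T.points l) a = -(simplexBasis T).coord i 0 := fun l hl => by
    have hzero : (simplexBasis T).coord i (T.points l) = 0 :=
      (simplexBasis T).coord_apply_ne hl.symm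
    exact eq_neg_of_add_eq_zero_left (by rw [← ha, hzero])
  have ha₀ : a ≠ 0 := by
    rintro rfl
    have : Nontrivial (Fin (n + 1)) := Fin.nontrivial_iff_two_le.2 (by omega)
    obtain ⟨l, hne⟩ := exists_ne i
    have := hl l hne
    simp only [inner_zero_right] at hi this
    linarith
  have hnorm : 0 < ‖a‖⁻¹ := inv_pos.2 (norm_pos_iff.2 ha₀)
  refine ⟨-(‖a‖⁻¹ • a), ?_, ‖a‖⁻¹ * (simplexBasis T).coord i 0, fun l hne => ?_, ?_⟩
  · rw [norm_neg, norm_smul, norm_inv, norm_norm, inv_mul_cancel₀ (norm_ne_zero_iff.2 ha₀)]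
  · rw [inner_neg_right, inner_smul_right, hl l hne, mul_neg, neg_neg]
  · rw [inner_neg_right, inner_smul_right, hi]
    linarith

theorem exists_normRatio_le_interpDirection (hn : 1 ≤ n) (hp : 1 < p) (hpq : p < q)
    (hK : IsConvexBody K) (hK₀ : IsCentered K) (hT₀ : IsCentered (solidSimplex T))
    (hu : IsOuterUnitNormal T i u) (hv : IsOuterUnitNormal T j v) (hij : i ≠ j)
    (hθ : θ ∈ Metric.sphere (0 : EuclideanSpace ℝ (Fin n)) 1) :
    ∃ s ∈ Set.Icc (0 : ℝ) 1, interpDirection u v s ∈ Metric.sphere 0 1 ∧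
      normRatio p q K θ ≤ normRatio p q (solidSimplex T) (interpDirection u v s) ∧
      (normRatio p q K θ = normRatio p q (solidSimplex T) (interpDirection u v s) →
        ∃ c : ℝ, 0 < c ∧ marginalLaw K θ =
          (marginalLaw (solidSimplex T) (interpDirection u v s)).map fun t => c * t) := by
  have hp₀ : 0 < p := zero_lt_one.trans hp
  have hq₀ : 0 < q := hp₀.trans hpq
  have hT := isConvexBody_solidSimplex T
  have hθ₀ : θ ≠ 0 := ne_zero_of_mem_unit_sphere ⟨θ, hθ⟩
  obtain ⟨s, hs, hsphere, c, hc, hdom⟩ :=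
    exists_isDominatedMarginal_smul_interpDirection hn hp hpq hK hK₀ hT₀ hθ₀ hu hv hij
  refine ⟨s, hs, hsphere, ?_⟩
  rw [← normRatio_smul (K := solidSimplex T) hc.ne']
  refine ⟨hdom.normRatio_le hK hT hp₀ hq₀, fun heq => ⟨c, hc, ?_⟩⟩
  rw [← marginalLaw_smul]
  exact hdom.marginalLaw_eq_of_normRatio_eq hK hT hp₀ hq₀ hθ₀ heq

lemma alpha_le_alpha_solidSimplex (hn : 1 ≤ n) (hp : 1 < p) (hpq : p < q) (hK : IsConvexBody K)
    (hK₀ : IsCentered K) (hT₀ : IsCentered (solidSimplex T)) :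
    alpha p q K ≤ alpha p q (solidSimplex T) := by
  have hp₀ : 0 < p := zero_lt_one.trans hp
  have hq₀ : 0 < q := hp₀.trans hpq
  have : Nontrivial (Fin (n + 1)) := Fin.nontrivial_iff_two_le.2 (by omega)
  obtain ⟨i, j, hij⟩ := exists_pair_ne (Fin (n + 1))
  obtain ⟨u, hu⟩ := exists_isOuterUnitNormal hn T i
  obtain ⟨v, hv⟩ := exists_isOuterUnitNormal hn T j
  obtain ⟨θ, hθ, hmax⟩ := (hK.isGreatest_alpha hn hp₀ hq₀).1
  obtain ⟨s, -, hsphere, hle, -⟩ :=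
    exists_normRatio_le_interpDirection hn hp hpq hK hK₀ hT₀ hu hv hij hθ
  rw [← hmax]
  exact hle.trans <| ((isConvexBody_solidSimplex T).isGreatest_alpha hn hp₀ hq₀).2
    (Set.mem_image_of_mem _ hsphere)

end

end NormRatio

theorem theorem1 (n : ℕ) (hn : 1 ≤ n) (p q : ℝ) (hp : 1 < p) (hpq : p < q)
    (K : Set (EuclideanSpace ℝ (Fin n))) (hK : IsConvexBody K) (hK0 : IsCentered K)
    (T : Affine.Simplex ℝ (EuclideanSpace ℝ (Fin n)) n) (hT0 : IsCentered (solidSimplex T)) :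
    -- the maxima defining `α(K)` and `α(Δₙ)` are attained
    IsGreatest (normRatio p q K '' Metric.sphere 0 1) (alpha p q K) ∧
    IsGreatest (normRatio p q (solidSimplex T) '' Metric.sphere 0 1)
      (alpha p q (solidSimplex T)) ∧
    alpha p q K ≤ alpha p q (solidSimplex T) ∧
    -- the one-parameter family of simplex marginals contains a maximizer, and contains
    -- every maximizing marginal of every centered convex body up to positive scaling
    ∀ (i j : Fin (n + 1)) (u v : EuclideanSpace ℝ (Fin n)), i ≠ j →
      IsOuterUnitNormal T i u → IsOuterUnitNormal T j v →
      (∃ s ∈ Set.Icc (0 : ℝ) 1,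
        normRatio p q (solidSimplex T) (interpDirection u v s) = alpha p q (solidSimplex T)) ∧
      ∀ θ ∈ Metric.sphere (0 : EuclideanSpace ℝ (Fin n)) 1,
        normRatio p q K θ = alpha p q (solidSimplex T) →
        ∃ s ∈ Set.Icc (0 : ℝ) 1, ∃ c : ℝ, 0 < c ∧
          marginalLaw K θ =
            (marginalLaw (solidSimplex T) (interpDirection u v s)).map (fun t => c * t) := by
  have hp₀ : 0 < p := zero_lt_one.trans hp
  have hq₀ : 0 < q := hp₀.trans hpq
  have hT := isConvexBody_solidSimplex T
  have hmaxT := hT.isGreatest_alpha hn hp₀ hq₀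
  refine ⟨hK.isGreatest_alpha hn hp₀ hq₀, hmaxT,
    alpha_le_alpha_solidSimplex hn hp hpq hK hK0 hT0,
    fun i j u v hij hu hv => ⟨?_, fun θ hθ hθmax => ?_⟩⟩
  · obtain ⟨θ, hθ, hθmax⟩ := hmaxT.1
    obtain ⟨s, hs, hsphere, hle, -⟩ :=
      exists_normRatio_le_interpDirection hn hp hpq hT hT0 hT0 hu hv hij hθ
    exact ⟨s, hs, (hmaxT.2 (Set.mem_image_of_mem _ hsphere)).antisymm (hθmax ▸ hle)⟩
  · obtain ⟨s, hs, hsphere, hle, hlaw⟩ :=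
      exists_normRatio_le_interpDirection hn hp hpq hK hK0 hT0 hu hv hij hθ
    exact ⟨s, hs, hlaw (hle.antisymm (hθmax ▸ hmaxT.2 (Set.mem_image_of_mem _ hsphere)))⟩
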